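/- **Setting.** An instance of $m$-CSP$'$ consists of $m\ge 1$ time slots $\mathcal T=\{1,\dots,m\}$ with capacities $C_t\ge 0$, a finite set $\mathcal N$ of users, and for each user $k$ a finite set $D_k$ of demands; the demand $(k,j)$, $j\in D_k$, has an interval of slots $T_{k,j}=\{t_1,\dots,t_2\}\subseteq\mathcal T$ (with $t_1\le t_2$), a complex number $s_{k,j}$ (the power demand, the same at every $t\in T_{k,j}$), and a utility $u_{k,j}>0$. Let $n=\sum_k|D_k|$ be the total number of demands. The problem is to find $x=(x_{k,j})\in\{0,1\}^n$ that maximizes $u(x)=\sum_{k}\sum_{j\in D_k}u_{k,j}x_{k,j}$ subject to $$\Big|\sum_{k\in\mathcal N}\ \sum_{j\in D_k:\,t\in T_{k,j}}s_{k,j}x_{k,j}\Big|\le C_t\quad(t\in\mathcal T),\qquad \sum_{j\in D_k}x_{k,j}\le 1\quad(k\in\mathcal N).$$ Let $\mathrm{Opt}$ be the maximum. An $(\alpha,1)$-approximation is an $x$ that satisfies all these constraints and $u(x)\ge\alpha\,\mathrm{Opt}$. The instance belongs to $m$-CSP$'[0,\frac\pi2]$ if $0\le\arg s_{k,j}\le\frac{\pi}{2}$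 for all $(k,j)$; put $\phi=\max_{k,j}\arg s_{k,j}$ (and $\phi=0$ if there are no demands; $\arg 0=0$). The no-bottleneck assumption is $\max_{k,j}|s_{k,j}|\le\min_{t\in\mathcal T}C_t$. **Theorem.** There is an algorithm that, on every instance of $m$-CSP$'[0,\frac{\pi}{2}]$ satisfying the no-bottleneck assumption, returns a $\big(\frac1{25}\cos\frac{\phi}{2},1\big)$-approximation, and hence an $(\alpha,1)$-approximation for an absolute constant $\alpha\in(0,1]$ (that is, an $(\Omega(1),1)$-approximation). Its running time is $O(n^2+m)$, so $O(n^2)$ when $m=O(n^2)$; here the algorithm is a single program for a real random access machine, which performs at unit cost reads and writes of array cells, the operations $+,-,\times,\div,\sqrt{\ }$ and comparisons on real numbers, and successor, predecessor and comparisons on indices, and the constant in $O(\cdot)$ is absolute. -/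

import Mathlib

noncomputable section

namespace CSP

/-! ### The scheduling problem with demands that are constant over their time interval -/

/-- An instance. The demands `(k, j)` of all users are listed as `i : Fin n`, so `n` is the
total number of demands (of 0/1 variables); `user i` is the user that declares demand `i`, and
the demand set of user `k` is `{i | user i = k}`. Demand `i` is the complex number `demand i` at
every slot of the interval `{first i, …, last i}`. -/
structure Instance where
  /-- number of time slots -/
  m : ℕ
  /-- number of users -/
  N : ℕ
  /-- number of demands -/
  n : ℕ
  m_pos : 0 < m
  cap : Fin m → ℝ
  cap_nonneg : ∀ t, 0 ≤ cap t
  user : Fin n → Fin N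
  first : Fin n → Fin m
  last : Fin n → Fin m
  first_le_last : ∀ i, first i ≤ last i
  demand : Fin n → ℂ
  utility : Fin n → ℝ
  utility_pos : ∀ i, 0 < utility i

namespace Instance

variable (I : Instance)

/-- The time interval of demand `i`. -/
def interval (i : Fin I.n) : Finset (Fin I.m) := Finset.Icc (I.first i) (I.last i)

/-- The total utility of a 0/1 vector. -/
def value (x : Fin I.n → ℕ) : ℝ := ∑ i, I.utility i * (x i : ℝ)

/-- The constraints, with the capacities multiplied by `β`. -/
structure Feasible (β : ℝ) (x : Fin I.n → ℕ) : Prop where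
  zero_or_one : ∀ i, x i = 0 ∨ x i = 1
  one_per_user : ∀ k : Fin I.N, ∑ i with I.user i = k, x i ≤ 1
  capacity : ∀ t : Fin I.m,
    ‖∑ i with t ∈ I.interval i, I.demand i * (x i : ℂ)‖ ≤ β * I.cap t

/-- The optimal value (a maximum, by `isGreatest_opt`). -/
def opt : ℝ := sSup (I.value '' {x | I.Feasible 1 x})

/-- `x` is an `(α, β)`-approximation. -/
def IsApprox (α β : ℝ) (x : Fin I.n → ℕ) : Prop :=
  I.Feasible β x ∧ α * I.opt ≤ I.value x

/-- The maximum argument `φ` of a demand (`0` if there are no demands). -/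
def maxArg : ℝ := ⨆ i, (I.demand i).arg

/-- The restriction of the problem to `[φ₁, φ₂]`. -/
def InSector (φ₁ φ₂ : ℝ) : Prop :=
  (∀ i, 0 ≤ (I.demand i).arg) ∧ φ₁ ≤ I.maxArg ∧ I.maxArg ≤ φ₂

/-- The no-bottleneck assumption: the largest demand is at most the smallest capacity. -/
def NoBottleneck : Prop := ∀ i t, ‖I.demand i‖ ≤ I.cap t

theorem isGreatest_opt : IsGreatest (I.value '' {x | I.Feasible 1 x}) I.opt := by
  have hfin : {x | I.Feasible 1 x}.Finite := by
    refine (Set.Finite.pi' (t := fun _ : Fin I.n => ({0, 1} : Set ℕ))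
      (fun _ => Set.toFinite _)).subset ?_
    intro x hx i
    simpa using hx.zero_or_one i
  have hne : (I.value '' {x | I.Feasible 1 x}).Nonempty := by
    refine ⟨_, 0, ⟨fun i => Or.inl rfl, fun k => by simp, fun t => ?_⟩, rfl⟩
    simpa using I.cap_nonneg t
  exact ⟨hne.csSup_mem (hfin.image _), fun y hy => le_csSup (hfin.image _).bddAbove hy⟩

end Instance

/-! ### The machine model: structured programs on a real random access machine -/

/-- The memory: arrays of natural numbers (indices, labels) and arrays of real numbers. -/
structure State where
  nat : ℕ → ℕ → ℕ
  real : ℕ → ℕ → ℝ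

/-- Index expressions. Successor and predecessor are the only operations, so that no index
exceeds the largest input index and program constant plus the running time. -/
inductive NatExpr where
  | const (c : ℕ)
  | read (a : ℕ) (i : NatExpr)
  | succ (e : NatExpr)
  | pred (e : NatExpr)

/-- Real expressions. -/
inductive RealExpr where
  | const (q : ℚ)
  | read (a : ℕ) (i : NatExpr)
  | add (e f : RealExpr)
  | sub (e f : RealExpr)
  | mul (e f : RealExpr)
  | div (e f : RealExpr)
  | sqrt (e : RealExpr)

/-- Tests. -/
inductive Test where
  | natLe (e f : NatExpr)
  | realLe (e f : RealExpr)
  | neg (b : Test)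
  | and (b c : Test)

/-- Programs. -/
inductive Prog where
  | skip
  | setNat (a : ℕ) (i e : NatExpr)
  | setReal (a : ℕ) (i : NatExpr) (e : RealExpr)
  | seq (p q : Prog)
  | cond (b : Test) (p q : Prog)
  | loop (b : Test) (p : Prog)

def NatExpr.eval (σ : State) : NatExpr → ℕ
  | .const c => c
  | .read a i => σ.nat a (i.eval σ)
  | .succ e => e.eval σ + 1
  | .pred e => e.eval σ - 1

def RealExpr.eval (σ : State) : RealExpr → ℝ
  | .const q => (q : ℝ)
  | .read a i => σ.real a (i.eval σ)
  | .add e f => e.eval σ + f.eval σ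
  | .sub e f => e.eval σ - f.eval σ
  | .mul e f => e.eval σ * f.eval σ
  | .div e f => e.eval σ / f.eval σ
  | .sqrt e => Real.sqrt (e.eval σ)

def Test.eval (σ : State) : Test → Prop
  | .natLe e f => e.eval σ ≤ f.eval σ
  | .realLe e f => e.eval σ ≤ f.eval σ
  | .neg b => ¬ b.eval σ
  | .and b c => b.eval σ ∧ c.eval σ

/-- The number of elementary operations (memory accesses included) of an evaluation. -/
def NatExpr.cost : NatExpr → ℕ
  | .const _ => 1
  | .read _ i => i.cost + 1
  | .succ e => e.cost + 1
  | .pred e => e.cost + 1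

def RealExpr.cost : RealExpr → ℕ
  | .const _ => 1
  | .read _ i => i.cost + 1
  | .add e f => e.cost + f.cost + 1
  | .sub e f => e.cost + f.cost + 1
  | .mul e f => e.cost + f.cost + 1
  | .div e f => e.cost + f.cost + 1
  | .sqrt e => e.cost + 1

def Test.cost : Test → ℕ
  | .natLe e f => e.cost + f.cost + 1
  | .realLe e f => e.cost + f.cost + 1
  | .neg b => b.cost + 1
  | .and b c => b.cost + c.cost + 1

def State.writeNat (σ : State) (a i v : ℕ) : State :=
  { σ with nat := Function.update σ.nat a (Function.update (σ.nat a) i v) }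

def State.writeReal (σ : State) (a i : ℕ) (v : ℝ) : State :=
  { σ with real := Function.update σ.real a (Function.update (σ.real a) i v) }

/-- `Exec p σ σ' c`: program `p`, started in state `σ`, halts in state `σ'` after `c` steps. -/
inductive Exec : Prog → State → State → ℕ → Prop where
  | skip (σ : State) : Exec .skip σ σ 1
  | setNat (a : ℕ) (i e : NatExpr) (σ : State) :
      Exec (.setNat a i e) σ (σ.writeNat a (i.eval σ) (e.eval σ)) (i.cost + e.cost + 1)
  | setReal (a : ℕ) (i : NatExpr) (e : RealExpr) (σ : State) :
      Exec (.setReal a i e) σ (σ.writeReal a (i.eval σ) (e.eval σ)) (i.cost + e.cost + 1)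
  | seq {p q : Prog} {σ σ' σ'' : State} {c d : ℕ} :
      Exec p σ σ' c → Exec q σ' σ'' d → Exec (.seq p q) σ σ'' (c + d)
  | condTrue {b : Test} {p q : Prog} {σ σ' : State} {c : ℕ} :
      b.eval σ → Exec p σ σ' c → Exec (.cond b p q) σ σ' (b.cost + c + 1)
  | condFalse {b : Test} {p q : Prog} {σ σ' : State} {c : ℕ} :
      ¬ b.eval σ → Exec q σ σ' c → Exec (.cond b p q) σ σ' (b.cost + c + 1)
  | loopFalse {b : Test} {p : Prog} {σ : State} :
      ¬ b.eval σ → Exec (.loop b p) σ σ (b.cost + 1)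
  | loopTrue {b : Test} {p : Prog} {σ σ' σ'' : State} {c d : ℕ} :
      b.eval σ → Exec p σ σ' c → Exec (.loop b p) σ' σ'' d →
      Exec (.loop b p) σ σ'' (b.cost + c + d + 1)

/-- The machine is deterministic: final state and running time are determined by the start. -/
theorem Exec.deterministic {p : Prog} {σ σ₁ σ₂ : State} {c₁ c₂ : ℕ}
    (h₁ : Exec p σ σ₁ c₁) (h₂ : Exec p σ σ₂ c₂) : σ₁ = σ₂ ∧ c₁ = c₂ := by
  induction h₁ generalizing σ₂ c₂ with
  | skip => cases h₂; exact ⟨rfl, rfl⟩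
  | setNat => cases h₂; exact ⟨rfl, rfl⟩
  | setReal => cases h₂; exact ⟨rfl, rfl⟩
  | seq _ _ ih₁ ih₂ =>
    cases h₂ with
    | seq a b =>
      obtain ⟨rfl, rfl⟩ := ih₁ a
      obtain ⟨rfl, rfl⟩ := ih₂ b
      exact ⟨rfl, rfl⟩
  | condTrue hb _ ih =>
    cases h₂ with
    | condTrue _ a => obtain ⟨rfl, rfl⟩ := ih a; exact ⟨rfl, rfl⟩
    | condFalse hn _ => exact absurd hb hn
  | condFalse hb _ ih =>
    cases h₂ with
    | condTrue hn _ => exact absurd hn hb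
    | condFalse _ a => obtain ⟨rfl, rfl⟩ := ih a; exact ⟨rfl, rfl⟩
  | loopFalse hb =>
    cases h₂ with
    | loopFalse _ => exact ⟨rfl, rfl⟩
    | loopTrue hn _ _ => exact absurd hn hb
  | loopTrue hb _ _ ih₁ ih₂ =>
    cases h₂ with
    | loopFalse hn => exact absurd hb hn
    | loopTrue _ a b =>
      obtain ⟨rfl, rfl⟩ := ih₁ a
      obtain ⟨rfl, rfl⟩ := ih₂ b
      exact ⟨rfl, rfl⟩

/-- A finite list of values as the contents of an array; the other cells hold `0`. -/
def toArray {α : Type} [Zero α] {l : ℕ} (f : Fin l → α) : ℕ → α :=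
  fun i => if h : i < l then f ⟨i, h⟩ else 0

/-- The initial memory on an instance. Natural arrays: `0` holds `n, m, N`; `1` the users;
`2` and `3` the first and last slots of the demands (all numbered from `0`). Real arrays: `0` holds
the capacities; `1` and `2` the real and imaginary parts of the demands; `3` the utilities. All
other cells hold `0`. -/
def Instance.input (I : Instance) : State where
  nat
    | 0 => toArray ![I.n, I.m, I.N]
    | 1 => toArray fun i => (I.user i : ℕ)
    | 2 => toArray fun i => (I.first i : ℕ)
    | 3 => toArray fun i => (I.last i : ℕ)
    | _ => fun _ => 0
  real
    | 0 => toArray I.cap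
    | 1 => toArray fun i => (I.demand i).re
    | 2 => toArray fun i => (I.demand i).im
    | 3 => toArray I.utility
    | _ => fun _ => 0

/-- The vector returned by a program: the first `n` cells of natural array `4`. -/
def Instance.output (I : Instance) (σ : State) : Fin I.n → ℕ := fun i => σ.nat 4 i

end CSP

end

noncomputable section

namespace CSP

open Finset Function

/-! Replace every demand by its absolute value. By the triangle inequality, a selection that is
feasible for the sizes `‖s‖` is feasible for the complex demands. Conversely, after a rotation by
`-φ/2` all demands lie within `φ/2` of the positive real axis, so an optimal solution has real load
at most `γ` times the capacity, with `γ = 1 / cos (φ/2)`. It therefore suffices to compare a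
selection that is feasible for real sizes with any set `T` of load at most `γ` times the capacities.

Let `D` (`top`) be the largest size; no capacity is below `D`. The demands are grouped by the
bottleneck capacity of their interval: a layer has an anchor `β` with `β ≤ bottleneck ≤ 4β`, the
lowest possible anchor is `D`, and distinct anchors differ by a factor of at least `4`. Each layer
is treated on its own, and only at its low slots (capacity at most `4β`). Demand `i` is represented
there by its last low slot `crit i`: a demand `j` of the same layer that ends no earlier obstructs
`i` by `size j / (κβ)` if it uses `crit i`, and by `1` if the users agree.

The local ratio method with these weights computes gains in the order of the last slots and then
selects greedily in the reverse order. Every `T` as above obstructs a demand by at most `1 + 4γ/κ`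
(`Layering.sum_weight_le`), so its utility is at most this factor times the sum of the gains
(`IsGain.sum_le`), and the selection is worth at least the sum of the gains (`IsGain.le_sum`).

For feasibility, the selected demands of a layer at a low slot have total size at most `κβ`, apart
from the one that ends first (`Layering.layer_low`). At any other slot the load of the layer at most
doubles, since each demand also uses the nearest low slot on the left or on the right
(`Layering.layer_le_two_mul`). The anchors grow geometrically, so the loads of all layers add up to
at most the capacity (`sum_loads_le`). The single exceptional demand is too big only in the lowest
layer, if it exceeds `D/2`. Such large demands are handled in a separate run (`κ = 1/2`), the others
with `κ = 3/10`, and the better result is returned; the two ratios add up to at most `25γ`.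

For the running time, the slots between consecutive starts and ends of intervals are replaced by one
of least capacity. At most `2n + 1` slots remain after `O(n + m)` steps, and everything else is a
fixed number of double loops. The program is verified by loop invariants with explicit step counts.
-/

/-- Demands of real sizes on intervals of slots, together with a grouping of the demands into
layers of demands with the same `anchor`, and an order `rank` that is compatible with the last
slots. A slot is low for a demand if its capacity is at most four times the anchor;
`crit i` is the last low slot of demand `i`. -/
structure Layering where
  n : ℕ
  user : ℕ → ℕ
  first : ℕ → ℕ
  last : ℕ → ℕ
  crit : ℕ → ℕ
  rank : ℕ → ℕ
  size : ℕ → ℝ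
  anchor : ℕ → ℝ
  top : ℝ
  slots : Set ℕ
  cap : ℕ → ℝ
  size_nonneg : ∀ i < n, 0 ≤ size i
  size_le : ∀ i < n, size i ≤ top
  top_nonneg : 0 ≤ top
  top_le_cap : ∀ s ∈ slots, top ≤ cap s
  top_le : ∀ i < n, top ≤ anchor i
  top_sep : ∀ i < n, anchor i = top ∨ 4 * top ≤ anchor i
  sep : ∀ i < n, ∀ j < n, anchor i < anchor j → 4 * anchor i ≤ anchor j
  anchor_le : ∀ i < n, ∀ s ∈ slots, first i ≤ s → s ≤ last i → anchor i ≤ cap s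
  crit_mem : ∀ i < n, crit i ∈ slots
  first_le_crit : ∀ i < n, first i ≤ crit i
  crit_le_last : ∀ i < n, crit i ≤ last i
  cap_crit : ∀ i < n, cap (crit i) ≤ 4 * anchor i
  le_crit : ∀ i < n, ∀ s ∈ slots, first i ≤ s → s ≤ last i → cap s ≤ 4 * anchor i → s ≤ crit i
  rank_inj : ∀ i < n, ∀ j < n, rank i = rank j → i = j
  last_le : ∀ i < n, ∀ j < n, rank i < rank j → last i ≤ last j

/-- The share of demand `j` in the obstruction of demand `i`. -/
def conflict (user first last crit : ℕ → ℕ) (size anchor : ℕ → ℝ) (κ : ℝ) (i j : ℕ) : ℝ :=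
  (if user i = user j then 1 else 0) +
    if anchor i = anchor j ∧ first j ≤ crit i ∧ crit i ≤ last j then size j / (κ * anchor i) else 0

/-- The dual gains of the local ratio method for the weights `a`. -/
def IsGain (n : ℕ) (rank : ℕ → ℕ) (w : ℕ → ℕ → ℝ) (a g : ℕ → ℝ) : Prop :=
  ∀ i < n, g i = max 0 (a i - ∑ j ∈ range n with rank j < rank i, g j * w j i)

/-- The set that the reverse greedy phase of the local ratio method selects. -/
def IsSelected (n : ℕ) (rank : ℕ → ℕ) (w : ℕ → ℕ → ℝ) (g : ℕ → ℝ) (S : Finset ℕ) : Prop :=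
  ∀ i, i ∈ S ↔ i < n ∧ 0 < g i ∧ ∑ j ∈ S with rank i < rank j, w i j < 1

/-! ### The local ratio method for abstract weights. -/

section LocalRatio

variable {n : ℕ} {rank : ℕ → ℕ} {w : ℕ → ℕ → ℝ} {a g : ℕ → ℝ} {S : Finset ℕ}

theorem IsGain.nonneg (h : IsGain n rank w a g) {i : ℕ} (hi : i < n) : 0 ≤ g i := by
  rw [h i hi]; exact le_max_left _ _

/-- An exchange of summation: the gain of `i` is charged to `i` itself and, with factor `w i j`, to
each later `j`. It is applied to a competing set for the upper bound and to the selected set for the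
lower bound. -/
theorem sum_gain_swap {T : Finset ℕ} (hT : T ⊆ range n) :
    ∑ j ∈ T, (g j + ∑ i ∈ range n with rank i < rank j, g i * w i j) =
      ∑ i ∈ range n, g i * ((if i ∈ T then 1 else 0) + ∑ j ∈ T with rank i < rank j, w i j) := by
  simp only [mul_add, Finset.sum_add_distrib, Finset.mul_sum, Finset.sum_filter]
  congr 1
  · simp only [mul_ite, mul_one, mul_zero]
    rw [← Finset.sum_filter, Finset.filter_mem_eq_inter, Finset.inter_eq_right.mpr hT]
  · rw [Finset.sum_comm]
    simp only [mul_ite, mul_zero]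

/-- Weak duality. The definition of the gains makes them cover each weight `a j`, and `ρ` bounds how
often the gain of one `i` is used in covering `T`. -/
theorem IsGain.sum_le (h : IsGain n rank w a g) {T : Finset ℕ} (hT : T ⊆ range n) {ρ : ℝ}
    (hρ : ∀ i < n, (if i ∈ T then 1 else 0) + ∑ j ∈ T with rank i < rank j, w i j ≤ ρ) :
    ∑ j ∈ T, a j ≤ ρ * ∑ i ∈ range n, g i := by
  calc ∑ j ∈ T, a j
      ≤ ∑ j ∈ T, (g j + ∑ i ∈ range n with rank i < rank j, g i * w i j) := by
        refine Finset.sum_le_sum fun j hj => ?_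
        have := le_max_right 0 (a j - ∑ i ∈ range n with rank i < rank j, g i * w i j)
        rw [← h j (mem_range.mp (hT hj))] at this
        linarith
    _ = _ := sum_gain_swap hT
    _ ≤ ∑ i ∈ range n, g i * ρ := by
        refine Finset.sum_le_sum fun i hi => ?_
        exact mul_le_mul_of_nonneg_left (hρ i (mem_range.mp hi)) (h.nonneg (mem_range.mp hi))
    _ = _ := by rw [← Finset.sum_mul, mul_comm]

theorem IsSelected.subset (hS : IsSelected n rank w g S) : S ⊆ range n :=
  fun i hi => mem_range.mpr ((hS i).mp hi).1

/-- Complementary slackness. A positive gain is counted at least once, either because `i` is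
selected or because later selected demands obstruct it by at least `1`; and the covering of a
selected weight is tight, because its gain is positive. -/
theorem IsGain.le_sum (h : IsGain n rank w a g) (hS : IsSelected n rank w g S)
    (hw : ∀ i < n, ∀ j < n, 0 ≤ w i j) : ∑ i ∈ range n, g i ≤ ∑ j ∈ S, a j := by
  calc ∑ i ∈ range n, g i
      ≤ ∑ i ∈ range n, g i * ((if i ∈ S then 1 else 0) + ∑ j ∈ S with rank i < rank j, w i j) := by
        refine Finset.sum_le_sum fun i hi => ?_
        have hi := mem_range.mp hi
        have hsum : 0 ≤ ∑ j ∈ S with rank i < rank j, w i j :=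
          Finset.sum_nonneg fun j hj =>
            hw i hi j (mem_range.mp (hS.subset (mem_filter.mp hj).1))
        rcases (h.nonneg hi).eq_or_lt with h0 | h0
        · rw [← h0]; simp
        · refine le_mul_of_one_le_right h0.le ?_
          by_cases hiS : i ∈ S
          · simp only [hiS, if_true]; linarith
          · have : ¬ ∑ j ∈ S with rank i < rank j, w i j < 1 := fun hlt =>
              hiS ((hS i).mpr ⟨hi, h0, hlt⟩)
            simp only [hiS, if_false]; linarith
    _ = ∑ j ∈ S, (g j + ∑ i ∈ range n with rank i < rank j, g i * w i j) :=
        (sum_gain_swap hS.subset).symm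
    _ ≤ _ := by
        refine Finset.sum_le_sum fun j hj => ?_
        obtain ⟨hjn, hpos, -⟩ := (hS j).mp hj
        have hg := h j hjn
        rcases max_choice 0 (a j - ∑ i ∈ range n with rank i < rank j, g i * w i j) with hm | hm
        · rw [hm] at hg; linarith
        · rw [hm] at hg; linarith

/-- A positive gain needs a positive weight. Hence demands whose weight is set to `0` are never
selected, and the method can be restricted to a class of demands by masking the weights. -/
theorem IsSelected.weight_pos (h : IsGain n rank w a g) (hS : IsSelected n rank w g S)
    (hw : ∀ i < n, ∀ j < n, 0 ≤ w i j) {i : ℕ} (hi : i ∈ S) : 0 < a i := by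
  obtain ⟨hin, hpos, -⟩ := (hS i).mp hi
  have hsum : 0 ≤ ∑ j ∈ range n with rank j < rank i, g j * w j i :=
    Finset.sum_nonneg fun j hj => by
      have hj := mem_range.mp (mem_filter.mp hj).1
      exact mul_nonneg (h.nonneg hj) (hw j hj i hin)
  have hg := h i hin
  by_contra hle
  rw [max_eq_left (by linarith)] at hg
  linarith

end LocalRatio

/-! ### Adding up the loads of the layers. -/

/-- A geometric estimate: values that grow by factors of at least `4`. -/
theorem sum_layers_le {D : ℝ} (hD : 0 ≤ D) {r : ℝ → ℝ} (hrD : r D ≤ 4 / 5 * D)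
    (hr : ∀ β, 4 * D ≤ β → r β ≤ 11 / 20 * β) (B : Finset ℝ) (hB : ∀ β ∈ B, D ≤ β)
    (hB' : ∀ β ∈ B, β = D ∨ 4 * D ≤ β) (hsep : ∀ β ∈ B, ∀ β' ∈ B, β < β' → 4 * β ≤ β')
    (X : ℝ) (hX0 : 0 ≤ X) (hX : ∀ β ∈ B, 4 * β ≤ X) : ∑ β ∈ B, 2 * r β ≤ 2 / 5 * X := by
  induction B using Finset.induction_on_max generalizing X with
  | empty => simpa using hX0
  | insert b B hb ih =>
    have hbX := hX b (mem_insert_self _ _)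
    have hDb := hB b (mem_insert_self _ _)
    rw [Finset.sum_insert (fun h => lt_irrefl _ (hb b h))]
    rcases hB' b (mem_insert_self _ _) with rfl | h4
    · have : B = ∅ := by
        refine Finset.eq_empty_of_forall_notMem fun β hβ => ?_
        exact absurd (hb β hβ) (not_lt.mpr (hB β (mem_insert_of_mem hβ)))
      subst this
      simp only [Finset.sum_empty]
      -- In the lowest layer `2 * (4/5) D = (2/5) * 4D`, which is where the factor `2/5` comes from.
      linarith
    -- The lower layers contribute at most `(2/5) b` by induction, and `11/10 + 2/5 = 3/2` is at
    -- most `(2/5) * 4`.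
    · have := ih (fun β hβ => hB β (mem_insert_of_mem hβ)) (fun β hβ => hB' β (mem_insert_of_mem hβ))
        (fun β hβ β' hβ' => hsep β (mem_insert_of_mem hβ) β' (mem_insert_of_mem hβ')) b
        (hD.trans hDb)
        (fun β hβ => hsep β (mem_insert_of_mem hβ) b (mem_insert_self _ _) (hb β hβ))
      have := hr b h4
      linarith

/-- By the separation of the anchors, at most one anchor `b` satisfies `b ≤ C < 4 * b`. The slot is
low for this layer, which therefore escapes the factor of two, and all other layers together
contribute at most `(2/5) b`. Since `11/20 + 2/5 < 1`, the sum stays below `b ≤ C`. -/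
theorem sum_loads_le {D C : ℝ} (hD : 0 ≤ D) {r L : ℝ → ℝ} (hrD : r D ≤ 4 / 5 * D)
    (hr : ∀ β, 4 * D ≤ β → r β ≤ 11 / 20 * β) (B : Finset ℝ) (hB : ∀ β ∈ B, D ≤ β)
    (hB' : ∀ β ∈ B, β = D ∨ 4 * D ≤ β) (hsep : ∀ β ∈ B, ∀ β' ∈ B, β < β' → 4 * β ≤ β')
    (hC : ∀ β ∈ B, β ≤ C) (hC0 : 0 ≤ C) (hL : ∀ β ∈ B, L β ≤ 2 * r β)
    (hLow : ∀ β ∈ B, C ≤ 4 * β → L β ≤ r β) : ∑ β ∈ B, L β ≤ C := by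
  by_cases hall : ∀ β ∈ B, 4 * β ≤ C
  · have := sum_layers_le hD hrD hr B hB hB' hsep C hC0 hall
    have := Finset.sum_le_sum hL
    linarith
  · push Not at hall
    obtain ⟨b, hbB, hb⟩ := hall
    have hmax : ∀ β ∈ B.erase b, 4 * β ≤ b := by
      intro β hβ
      obtain ⟨hne, hβB⟩ := mem_erase.mp hβ
      rcases lt_or_gt_of_ne hne with h | h
      · exact hsep β hβB b hbB h
      · have := hsep b hbB β hβB h
        have := hC β hβB
        linarith
    have hDb := hB b hbB
    have h1 := sum_layers_le hD hrD hr (B.erase b) (fun β hβ => hB β (mem_of_mem_erase hβ))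
      (fun β hβ => hB' β (mem_of_mem_erase hβ))
      (fun β hβ β' hβ' => hsep β (mem_of_mem_erase hβ) β' (mem_of_mem_erase hβ')) b
      (hD.trans hDb) hmax
    have h2 := Finset.sum_le_sum fun β hβ => hL β (mem_of_mem_erase (a := b) hβ)
    have h3 := hLow b hbB hb.le
    have h4 := hC b hbB
    rw [← Finset.add_sum_erase B L hbB]
    rcases hB' b hbB with h | h
    -- A remaining `β` would satisfy `4 * β ≤ D ≤ β`. This is possible only for `β = D = 0`, and
    -- then `β` is the erased anchor.
    · have hempty : B.erase b = ∅ := by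
        refine Finset.eq_empty_of_forall_notMem fun β hβ => ?_
        have e1 := hmax β hβ
        have e2 := hB β (mem_of_mem_erase hβ)
        have e3 : β = b := by linarith
        exact (mem_erase.mp hβ).1 e3
      rw [hempty, Finset.sum_empty]
      subst h
      linarith
    · have := hr b h
      linarith

/-! ### Load and value of the selections in a layered instance. -/

namespace Layering

variable (Λ : Layering)

def weight (κ : ℝ) : ℕ → ℕ → ℝ :=
  conflict Λ.user Λ.first Λ.last Λ.crit Λ.size Λ.anchor κ

/-- The total size of the demands of `S` at slot `s`. -/
def load (S : Finset ℕ) (s : ℕ) : ℝ :=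
  ∑ j ∈ S with Λ.first j ≤ s ∧ s ≤ Λ.last j, Λ.size j

theorem anchor_nonneg {i : ℕ} (hi : i < Λ.n) : 0 ≤ Λ.anchor i :=
  Λ.top_nonneg.trans (Λ.top_le i hi)

theorem weight_nonneg {κ : ℝ} (hκ : 0 ≤ κ) (i : ℕ) (hi : i < Λ.n) (j : ℕ) (hj : j < Λ.n) :
    0 ≤ Λ.weight κ i j := by
  have := div_nonneg (Λ.size_nonneg j hj) (mul_nonneg hκ (Λ.anchor_nonneg hi))
  unfold weight conflict
  split_ifs <;> linarith

/-- The user part contributes at most `1`, since `T` has at most one demand of the user of `i`, be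
it `i` itself or another one. For the capacity part, all demands counted use the slot `crit i`,
where `T` has load at most `γ * cap (crit i) ≤ 4 * γ * anchor i`. -/
theorem sum_weight_le {κ γ : ℝ} (hκ : 0 < κ) (hγ : 0 ≤ γ) {T : Finset ℕ} (hT : T ⊆ range Λ.n)
    (huser : ∀ i ∈ T, ∀ j ∈ T, Λ.user i = Λ.user j → i = j)
    (hload : ∀ s ∈ Λ.slots, Λ.load T s ≤ γ * Λ.cap s) {i : ℕ} (hi : i < Λ.n) :
    (if i ∈ T then 1 else 0) + ∑ j ∈ T with Λ.rank i < Λ.rank j, Λ.weight κ i j ≤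
      1 + 4 * γ / κ := by
  have hβ := Λ.anchor_nonneg hi
  have hnn : ∀ j ∈ T, 0 ≤ Λ.size j / (κ * Λ.anchor i) := fun j hj =>
    div_nonneg (Λ.size_nonneg j (mem_range.mp (hT hj))) (mul_nonneg hκ.le hβ)
  have hcap : ∑ j ∈ T with Λ.rank i < Λ.rank j,
      (if Λ.anchor i = Λ.anchor j ∧ Λ.first j ≤ Λ.crit i ∧ Λ.crit i ≤ Λ.last j then
        Λ.size j / (κ * Λ.anchor i) else 0) ≤ 4 * γ / κ := by
    calc _ ≤ ∑ j ∈ T with Λ.first j ≤ Λ.crit i ∧ Λ.crit i ≤ Λ.last j,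
            Λ.size j / (κ * Λ.anchor i) := by
          rw [Finset.sum_filter, Finset.sum_filter]
          refine Finset.sum_le_sum fun j hj => ?_
          have := hnn j hj
          split_ifs <;> first | rfl | assumption | (exfalso; tauto)
      _ = Λ.load T (Λ.crit i) / (κ * Λ.anchor i) := by
          rw [← Finset.sum_div]; rfl
      _ ≤ γ * (4 * Λ.anchor i) / (κ * Λ.anchor i) := by
          have h1 := hload _ (Λ.crit_mem i hi)
          have h2 := mul_le_mul_of_nonneg_left (Λ.cap_crit i hi) hγ
          exact div_le_div_of_nonneg_right (h1.trans h2) (mul_nonneg hκ.le hβ)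
      _ ≤ 4 * γ / κ := by
          -- For anchor `0` the quotient is `0` by the convention on division by zero.
          rcases hβ.eq_or_lt with h | h
          · rw [← h]; simp only [mul_zero, div_zero]; positivity
          · apply le_of_eq; field_simp
  have hus : (if i ∈ T then (1 : ℝ) else 0) + ∑ j ∈ T with Λ.rank i < Λ.rank j,
      (if Λ.user i = Λ.user j then (1 : ℝ) else 0) ≤ 1 := by
    by_cases hiT : i ∈ T
    · rw [Finset.sum_eq_zero]
      · simp [hiT]
      · intro j hj
        obtain ⟨hjT, hlt⟩ := mem_filter.mp hj
        rw [if_neg]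
        intro h
        have := huser i hiT j hjT h
        subst this
        exact lt_irrefl _ hlt
    · simp only [hiT, if_false, zero_add]
      rw [← Finset.sum_filter, Finset.sum_const, nsmul_eq_mul, mul_one]
      have : (filter (fun j => Λ.user i = Λ.user j) (filter (fun j => Λ.rank i < Λ.rank j) T)).card ≤ 1 := by
        rw [Finset.card_le_one]
        intro x hx y hy
        simp only [mem_filter] at hx hy
        exact huser x hx.1.1 y hy.1.1 (hx.2.symm.trans hy.2)
      exact_mod_cast this
  simp only [weight, conflict, Finset.sum_add_distrib]
  linarith

section Selected

variable {κ : ℝ} {g : ℕ → ℝ} {S : Finset ℕ}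

/-- The part of the demands of `S` in the layer of anchor `β` that use slot `s`. -/
def layer (S : Finset ℕ) (β : ℝ) (s : ℕ) : Finset ℕ :=
  {j ∈ S | (Λ.first j ≤ s ∧ s ≤ Λ.last j) ∧ Λ.anchor j = β}

/-- A common user alone contributes a full `1` to the obstruction, which must stay below `1`. -/
theorem user_injOn (hκ : 0 ≤ κ) (hS : IsSelected Λ.n Λ.rank (Λ.weight κ) g S) :
    ∀ i ∈ S, ∀ j ∈ S, Λ.user i = Λ.user j → i = j := by
  have key : ∀ i ∈ S, ∀ j ∈ S, Λ.user i = Λ.user j → ¬ Λ.rank i < Λ.rank j := by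
    intro i hi j hj hu hlt
    obtain ⟨hin, -, hsum⟩ := (hS i).mp hi
    have h1 : Λ.weight κ i j ≤ ∑ j ∈ S with Λ.rank i < Λ.rank j, Λ.weight κ i j :=
      Finset.single_le_sum (f := fun j => Λ.weight κ i j)
        (fun k hk => Λ.weight_nonneg hκ i hin k
        (mem_range.mp (hS.subset (mem_filter.mp hk).1))) (mem_filter.mpr ⟨hj, hlt⟩)
    have h2 : 1 ≤ Λ.weight κ i j := by
      have := div_nonneg (Λ.size_nonneg j (mem_range.mp (hS.subset hj)))
        (mul_nonneg hκ (Λ.anchor_nonneg hin))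
      unfold weight conflict
      rw [if_pos hu]
      split_ifs <;> linarith
    linarith
  intro i hi j hj hu
  refine Λ.rank_inj i (mem_range.mp (hS.subset hi)) j (mem_range.mp (hS.subset hj)) ?_
  exact le_antisymm (not_lt.mp (key j hj i hi hu.symm)) (not_lt.mp (key i hi j hj hu))

/-- At a low slot, all demands of a layer but one have a small total size. -/
theorem layer_low (hκ : 0 < κ) (hS : IsSelected Λ.n Λ.rank (Λ.weight κ) g S) {β : ℝ} {s : ℕ}
    (hs : s ∈ Λ.slots) (hlow : Λ.cap s ≤ 4 * β) (hne : (Λ.layer S β s).Nonempty) :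
    ∃ i ∈ Λ.layer S β s, ∑ j ∈ (Λ.layer S β s).erase i, Λ.size j ≤ κ * β := by
  -- The exceptional demand is the one of least rank: when it was selected, all others of the layer
  -- were already there.
  obtain ⟨i, hi, hmin⟩ := Finset.exists_min_image _ Λ.rank hne
  refine ⟨i, hi, ?_⟩
  obtain ⟨hiS, ⟨hfi, hli⟩, hβ⟩ := mem_filter.mp hi
  obtain ⟨hin, -, hsum⟩ := (hS i).mp hiS
  have hβ0 : 0 ≤ β := hβ ▸ Λ.anchor_nonneg hin
  have hmem : ∀ j ∈ (Λ.layer S β s).erase i, j < Λ.n := fun j hj =>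
    mem_range.mp (hS.subset (mem_filter.mp (mem_of_mem_erase hj)).1)
  -- For anchor `0` the weights carry no information, but then `top = 0` and all sizes vanish.
  rcases hβ0.eq_or_lt with h | h
  · refine (Finset.sum_nonpos ?_).trans (by rw [← h, mul_zero])
    intro j hj
    have h1 := Λ.size_le j (hmem j hj)
    have h2 := Λ.top_le i hin
    linarith
  · have h1 : ∑ j ∈ (Λ.layer S β s).erase i, Λ.size j / (κ * β) ≤
        ∑ j ∈ S with Λ.rank i < Λ.rank j, Λ.weight κ i j := by
      calc _ ≤ ∑ j ∈ (Λ.layer S β s).erase i, Λ.weight κ i j := by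
            refine Finset.sum_le_sum fun j hj => ?_
            obtain ⟨hjS, ⟨hfj, hlj⟩, hβj⟩ := mem_filter.mp (mem_of_mem_erase hj)
            have hjn := hmem j hj
            have hrank : Λ.rank i < Λ.rank j :=
              lt_of_le_of_ne (hmin j (mem_of_mem_erase hj)) fun h =>
                (mem_erase.mp hj).1 (Λ.rank_inj i hin j hjn h).symm
            -- Demand `j` uses `crit i`: it starts by `s`, which is a low slot and so not after
            -- `crit i`, and its higher rank means that it ends no earlier than `i`.
            have hsc := Λ.le_crit i hin s hs hfi hli (by rw [hβ]; exact hlow)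
            have hcl := (Λ.crit_le_last i hin).trans (Λ.last_le i hin j hjn hrank)
            unfold weight conflict
            rw [if_pos (show Λ.anchor i = Λ.anchor j ∧ Λ.first j ≤ Λ.crit i ∧ Λ.crit i ≤ Λ.last j
              from ⟨hβ.trans hβj.symm, hfj.trans hsc, hcl⟩), hβ]
            split_ifs <;> linarith
        _ ≤ _ := by
            refine Finset.sum_le_sum_of_subset_of_nonneg ?_ fun k hk _ =>
              Λ.weight_nonneg hκ.le i hin k (mem_range.mp (hS.subset (mem_filter.mp hk).1))
            intro j hj
            refine mem_filter.mpr ⟨(mem_filter.mp (mem_of_mem_erase hj)).1, ?_⟩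
            exact lt_of_le_of_ne (hmin j (mem_of_mem_erase hj)) fun h =>
                (mem_erase.mp hj).1 (Λ.rank_inj i hin j (hmem j hj) h).symm
    rw [← Finset.sum_div] at h1
    have h2 := h1.trans_lt hsum
    rw [div_lt_one (by positivity)] at h2
    exact h2.le

/-- The nearest places with property `P` on the left and on the right of `s`; where there is none,
the value is arbitrary. -/
theorem exists_low {P : ℕ → Prop} (s : ℕ) :
    ∃ s₁ s₂ : ℕ, ((∃ t < s, P t) → s₁ < s ∧ P s₁ ∧ ∀ t < s, P t → t ≤ s₁) ∧
      ((∃ t, s < t ∧ P t) → s < s₂ ∧ P s₂ ∧ ∀ t, s < t → P t → s₂ ≤ t) := by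
  classical
  have h1 : ∃ s₁ : ℕ, (∃ t < s, P t) → s₁ < s ∧ P s₁ ∧ ∀ t < s, P t → t ≤ s₁ := by
    by_cases h : ∃ t < s, P t
    · obtain ⟨t, ht, hPt⟩ := h
      obtain ⟨x, hx, hmax⟩ := Finset.exists_max_image ((range s).filter P) id
        ⟨t, mem_filter.mpr ⟨mem_range.mpr ht, hPt⟩⟩
      obtain ⟨hxs, hPx⟩ := mem_filter.mp hx
      exact ⟨x, fun _ => ⟨mem_range.mp hxs, hPx, fun t ht hPt =>
        hmax t (mem_filter.mpr ⟨mem_range.mpr ht, hPt⟩)⟩⟩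
    · exact ⟨0, fun h' => absurd h' h⟩
  have h2 : ∃ s₂ : ℕ, (∃ t, s < t ∧ P t) → s < s₂ ∧ P s₂ ∧ ∀ t, s < t → P t → s₂ ≤ t := by
    by_cases h : ∃ t, s < t ∧ P t
    · exact ⟨Nat.find h, fun _ => ⟨(Nat.find_spec h).1, (Nat.find_spec h).2,
        fun t h1 h2 => Nat.find_min' h ⟨h1, h2⟩⟩⟩
    · exact ⟨0, fun h' => absurd h' h⟩
  obtain ⟨s₁, h1⟩ := h1
  obtain ⟨s₂, h2⟩ := h2
  exact ⟨s₁, s₂, h1, h2⟩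

/-- A bound for the load of a layer at low slots holds up to a factor of two at all slots. -/
theorem layer_le_two_mul {T : Finset ℕ} (hT : T ⊆ range Λ.n) {β r : ℝ} (hr : 0 ≤ r)
    (hlow : ∀ s ∈ Λ.slots, Λ.cap s ≤ 4 * β → ∑ j ∈ Λ.layer T β s, Λ.size j ≤ r)
    {s : ℕ} (hs : s ∈ Λ.slots) : ∑ j ∈ Λ.layer T β s, Λ.size j ≤ 2 * r := by
  classical
  by_cases hsl : Λ.cap s ≤ 4 * β
  · have := hlow s hs hsl
    linarith
  obtain ⟨s₁, s₂, h1, h2⟩ := exists_low (P := fun t => t ∈ Λ.slots ∧ Λ.cap t ≤ 4 * β) s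
  have hn : ∀ t, ∀ j ∈ Λ.layer T β t, 0 ≤ Λ.size j := fun t j hj =>
    Λ.size_nonneg j (mem_range.mp (hT (mem_filter.mp hj).1))
  -- Each demand of the layer has its own low slot `crit j`. If this lies before `s`, the demand
  -- also uses the last low slot before `s`; if after, the first low slot after `s`. So each of the
  -- two parts is bounded by the load at one low slot.
  let A := (Λ.layer T β s).filter fun j => Λ.crit j < s
  let B := (Λ.layer T β s).filter fun j => ¬ Λ.crit j < s
  have hsplit : ∑ j ∈ Λ.layer T β s, Λ.size j = ∑ j ∈ A, Λ.size j + ∑ j ∈ B, Λ.size j :=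
    (Finset.sum_filter_add_sum_filter_not _ _ _).symm
  have hA : ∑ j ∈ A, Λ.size j ≤ r := by
    rcases A.eq_empty_or_nonempty with h | ⟨a, ha⟩
    · rw [h, Finset.sum_empty]; exact hr
    · have key : ∀ j ∈ A, ∃ t < s, (t ∈ Λ.slots ∧ Λ.cap t ≤ 4 * β) ∧ Λ.first j ≤ t := by
        intro j hj
        obtain ⟨hj', hc⟩ := mem_filter.mp hj
        obtain ⟨hjT, -, hβ⟩ := mem_filter.mp hj'
        have hjn := mem_range.mp (hT hjT)
        exact ⟨Λ.crit j, hc, ⟨Λ.crit_mem j hjn, hβ ▸ Λ.cap_crit j hjn⟩, Λ.first_le_crit j hjn⟩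
      obtain ⟨t, hts, htP, -⟩ := key a ha
      obtain ⟨hs₁, hP₁, hmax⟩ := h1 ⟨t, hts, htP⟩
      refine le_trans (Finset.sum_le_sum_of_subset_of_nonneg ?_ fun j hj _ => hn s₁ j hj)
        (hlow s₁ hP₁.1 hP₁.2)
      intro j hj
      obtain ⟨t, hts, htP, hft⟩ := key j hj
      obtain ⟨hjT, ⟨-, hl⟩, hβ⟩ := mem_filter.mp (mem_filter.mp hj).1
      exact mem_filter.mpr ⟨hjT, ⟨hft.trans (hmax t hts htP), hs₁.le.trans hl⟩, hβ⟩
  have hB : ∑ j ∈ B, Λ.size j ≤ r := by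
    rcases B.eq_empty_or_nonempty with h | ⟨a, ha⟩
    · rw [h, Finset.sum_empty]; exact hr
    · have key : ∀ j ∈ B, ∃ t, s < t ∧ (t ∈ Λ.slots ∧ Λ.cap t ≤ 4 * β) ∧ t ≤ Λ.last j := by
        intro j hj
        obtain ⟨hj', hc⟩ := mem_filter.mp hj
        obtain ⟨hjT, -, hβ⟩ := mem_filter.mp hj'
        have hjn := mem_range.mp (hT hjT)
        have hcc : Λ.cap (Λ.crit j) ≤ 4 * β := hβ ▸ Λ.cap_crit j hjn
        refine ⟨Λ.crit j, lt_of_le_of_ne (not_lt.mp hc) ?_, ⟨Λ.crit_mem j hjn, hcc⟩,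
          Λ.crit_le_last j hjn⟩
        intro h
        exact hsl (h ▸ hcc)
      obtain ⟨t, hts, htP, -⟩ := key a ha
      obtain ⟨hs₂, hP₂, hmin⟩ := h2 ⟨t, hts, htP⟩
      refine le_trans (Finset.sum_le_sum_of_subset_of_nonneg ?_ fun j hj _ => hn s₂ j hj)
        (hlow s₂ hP₂.1 hP₂.2)
      intro j hj
      obtain ⟨t, hts, htP, hlt⟩ := key j hj
      obtain ⟨hjT, ⟨hf, -⟩, hβ⟩ := mem_filter.mp (mem_filter.mp hj).1
      exact mem_filter.mpr ⟨hjT, ⟨hf.trans hs₂.le, (hmin t hts htP).trans hlt⟩, hβ⟩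
  linarith

/-- A demand is large if it is in the lowest layer and exceeds half of the size bound. -/
def Large (i : ℕ) : Prop := Λ.anchor i = Λ.top ∧ Λ.top < 2 * Λ.size i

/-- With `κ = 1/2`, the demands at a low slot other than the exceptional one have total size at most
`D/2`, while each of them exceeds `D/2`; so there is only one demand, of size at most `D`. At the
other slots the load is at most `2D`, and the capacity exceeds `4D`. -/
theorem load_le_of_large (hS : IsSelected Λ.n Λ.rank (Λ.weight (1 / 2)) g S)
    (hlarge : ∀ i ∈ S, Λ.Large i) {s : ℕ} (hs : s ∈ Λ.slots) : Λ.load S s ≤ Λ.cap s := by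
  have hlayer : ∀ s, Λ.load S s = ∑ j ∈ Λ.layer S Λ.top s, Λ.size j := by
    intro s
    refine Finset.sum_congr (Finset.filter_congr fun j hj => ?_) fun _ _ => rfl
    simp [(hlarge j hj).1]
  have hlow : ∀ s ∈ Λ.slots, Λ.cap s ≤ 4 * Λ.top →
      ∑ j ∈ Λ.layer S Λ.top s, Λ.size j ≤ Λ.top := by
    intro s hs hc
    rcases (Λ.layer S Λ.top s).eq_empty_or_nonempty with h | h
    · rw [h, Finset.sum_empty]; exact Λ.top_nonneg
    obtain ⟨i, hi, hle⟩ := Λ.layer_low (by norm_num) hS hs hc h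
    have hmem : ∀ j ∈ Λ.layer S Λ.top s, j ∈ S := fun j hj => (mem_filter.mp hj).1
    have hempty : (Λ.layer S Λ.top s).erase i = ∅ := by
      refine Finset.eq_empty_of_forall_notMem fun j hj => ?_
      have h1 := (hlarge j (hmem j (mem_of_mem_erase hj))).2
      have h2 : Λ.size j ≤ ∑ j ∈ (Λ.layer S Λ.top s).erase i, Λ.size j :=
        Finset.single_le_sum (f := Λ.size) (fun k hk => Λ.size_nonneg k
          (mem_range.mp (hS.subset (hmem k (mem_of_mem_erase hk))))) hj
      linarith
    rw [← Finset.add_sum_erase _ _ hi, hempty, Finset.sum_empty, add_zero]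
    exact Λ.size_le i (mem_range.mp (hS.subset (hmem i hi)))
  rw [hlayer]
  by_cases hc : Λ.cap s ≤ 4 * Λ.top
  · exact (hlow s hs hc).trans (Λ.top_le_cap s hs)
  · have := Λ.layer_le_two_mul hS.subset Λ.top_nonneg hlow hs
    have := Λ.top_nonneg
    linarith

/-- At a low slot a layer has load at most `(3/10) β` plus one demand. That demand is at most `D/2`
in the lowest layer, which gives `(4/5) D`, and at most `D ≤ β/4` in a layer with `4D ≤ β`, which
gives `(11/20) β`. These are the constants of `sum_loads_le`. -/
theorem load_le_of_small (hS : IsSelected Λ.n Λ.rank (Λ.weight (3 / 10)) g S)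
    (hsmall : ∀ i ∈ S, ¬ Λ.Large i) {s : ℕ} (hs : s ∈ Λ.slots) : Λ.load S s ≤ Λ.cap s := by
  classical
  let r : ℝ → ℝ := fun β => 3 / 10 * β + if β = Λ.top then 1 / 2 * Λ.top else Λ.top
  have h0 := Λ.top_nonneg
  have hr0 : ∀ β, 0 ≤ β → 0 ≤ r β := by
    intro β hβ
    simp only [r]
    split_ifs <;> linarith
  let B := (S.filter fun j => Λ.first j ≤ s ∧ s ≤ Λ.last j).image Λ.anchor
  have hBmem : ∀ β ∈ B, ∃ j ∈ S, (Λ.first j ≤ s ∧ s ≤ Λ.last j) ∧ Λ.anchor j = β := by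
    intro β hβ
    obtain ⟨j, hj, rfl⟩ := mem_image.mp hβ
    obtain ⟨h1, h2⟩ := mem_filter.mp hj
    exact ⟨j, h1, h2, rfl⟩
  have hlt : ∀ j ∈ S, j < Λ.n := fun j hj => mem_range.mp (hS.subset hj)
  have hlow : ∀ β, 0 ≤ β → ∀ s ∈ Λ.slots, Λ.cap s ≤ 4 * β →
      ∑ j ∈ Λ.layer S β s, Λ.size j ≤ r β := by
    intro β hβ s hs hc
    rcases (Λ.layer S β s).eq_empty_or_nonempty with h | h
    · rw [h, Finset.sum_empty]; exact hr0 β hβ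
    obtain ⟨i, hi, hle⟩ := Λ.layer_low (by norm_num) hS hs hc h
    obtain ⟨hiS, -, hiβ⟩ := mem_filter.mp hi
    rw [← Finset.add_sum_erase _ _ hi]
    simp only [r]
    split_ifs with hD
    · have : ¬ Λ.top < 2 * Λ.size i := fun hh => hsmall i hiS ⟨hiβ.trans hD, hh⟩
      linarith
    · have := Λ.size_le i (hlt i hiS)
      linarith
  have hload : Λ.load S s = ∑ β ∈ B, ∑ j ∈ Λ.layer S β s, Λ.size j := by
    unfold load
    rw [← Finset.sum_fiberwise_of_maps_to (t := B) (g := Λ.anchor)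
      (fun j hj => mem_image_of_mem _ hj)]
    refine Finset.sum_congr rfl fun β _ => ?_
    rw [Finset.filter_filter]
    rfl
  rw [hload]
  have hB0 : ∀ β ∈ B, 0 ≤ β := by
    intro β hβ
    obtain ⟨j, hj, -, rfl⟩ := hBmem β hβ
    exact Λ.anchor_nonneg (hlt j hj)
  refine sum_loads_le h0 (r := r) ?_ ?_ B ?_ ?_ ?_ ?_ ?_ ?_ ?_
  · simp only [r, if_true]; linarith
  · intro β hβ
    simp only [r]
    split_ifs <;> linarith
  · intro β hβ
    obtain ⟨j, hj, -, rfl⟩ := hBmem β hβ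
    exact Λ.top_le j (hlt j hj)
  · intro β hβ
    obtain ⟨j, hj, -, rfl⟩ := hBmem β hβ
    exact Λ.top_sep j (hlt j hj)
  · intro β hβ β' hβ' h
    obtain ⟨j, hj, -, rfl⟩ := hBmem β hβ
    obtain ⟨j', hj', -, rfl⟩ := hBmem β' hβ'
    exact Λ.sep j (hlt j hj) j' (hlt j' hj') h
  · intro β hβ
    obtain ⟨j, hj, hs', rfl⟩ := hBmem β hβ
    exact Λ.anchor_le j (hlt j hj) s hs hs'.1 hs'.2
  · exact h0.trans (Λ.top_le_cap s hs)
  · intro β hβ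
    exact Λ.layer_le_two_mul hS.subset (hr0 β (hB0 β hβ)) (hlow β (hB0 β hβ)) hs
  · intro β hβ hc
    exact hlow β (hB0 β hβ) s hs hc

end Selected

/-- The better one of the selections for the large and for the small demands. -/
theorem value_le {γ : ℝ} (hγ : 1 ≤ γ) {u a₁ a₂ g₁ g₂ : ℕ → ℝ} {S₁ S₂ T : Finset ℕ}
    (ha₁ : ∀ i < Λ.n, (Λ.Large i → a₁ i = 0) ∧ (¬ Λ.Large i → a₁ i = u i))
    (ha₂ : ∀ i < Λ.n, (Λ.Large i → a₂ i = u i) ∧ (¬ Λ.Large i → a₂ i = 0))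
    (hu : ∀ i < Λ.n, 0 ≤ u i)
    (hg₁ : IsGain Λ.n Λ.rank (Λ.weight (3 / 10)) a₁ g₁)
    (hg₂ : IsGain Λ.n Λ.rank (Λ.weight (1 / 2)) a₂ g₂)
    (hS₁ : IsSelected Λ.n Λ.rank (Λ.weight (3 / 10)) g₁ S₁)
    (hS₂ : IsSelected Λ.n Λ.rank (Λ.weight (1 / 2)) g₂ S₂)
    (hT : T ⊆ range Λ.n) (huser : ∀ i ∈ T, ∀ j ∈ T, Λ.user i = Λ.user j → i = j)
    (hload : ∀ s ∈ Λ.slots, Λ.load T s ≤ γ * Λ.cap s) :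
    ∑ i ∈ T, u i ≤ 25 * γ * max (∑ i ∈ S₁, u i) (∑ i ∈ S₂, u i) := by
  have hγ0 : 0 ≤ γ := by linarith
  have hle₁ : ∀ i < Λ.n, a₁ i ≤ u i := by
    intro i hi
    by_cases h : Λ.Large i
    · rw [(ha₁ i hi).1 h]; exact hu i hi
    · rw [(ha₁ i hi).2 h]
  have hle₂ : ∀ i < Λ.n, a₂ i ≤ u i := by
    intro i hi
    by_cases h : Λ.Large i
    · rw [(ha₂ i hi).1 h]
    · rw [(ha₂ i hi).2 h]; exact hu i hi
  have h1 := hg₁.sum_le hT fun i hi =>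
    Λ.sum_weight_le (κ := 3 / 10) (by norm_num) hγ0 hT huser hload hi
  have h2 := hg₂.sum_le hT fun i hi =>
    Λ.sum_weight_le (κ := 1 / 2) (by norm_num) hγ0 hT huser hload hi
  have h3 := hg₁.le_sum hS₁ (Λ.weight_nonneg (by norm_num))
  have h4 := hg₂.le_sum hS₂ (Λ.weight_nonneg (by norm_num))
  have h5 : ∑ i ∈ S₁, a₁ i ≤ ∑ i ∈ S₁, u i :=
    Finset.sum_le_sum fun i hi => hle₁ i (mem_range.mp (hS₁.subset hi))
  have h6 : ∑ i ∈ S₂, a₂ i ≤ ∑ i ∈ S₂, u i :=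
    Finset.sum_le_sum fun i hi => hle₂ i (mem_range.mp (hS₂.subset hi))
  have hsum : ∑ i ∈ T, u i = ∑ i ∈ T, a₁ i + ∑ i ∈ T, a₂ i := by
    rw [← Finset.sum_add_distrib]
    refine Finset.sum_congr rfl fun i hi => ?_
    have hi := mem_range.mp (hT hi)
    by_cases h : Λ.Large i
    · rw [(ha₁ i hi).1 h, (ha₂ i hi).1 h, zero_add]
    · rw [(ha₁ i hi).2 h, (ha₂ i hi).2 h, add_zero]
  have h7 := le_max_left (∑ i ∈ S₁, u i) (∑ i ∈ S₂, u i)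
  have h8 := le_max_right (∑ i ∈ S₁, u i) (∑ i ∈ S₂, u i)
  set V := max (∑ i ∈ S₁, u i) (∑ i ∈ S₂, u i)
  have h9 : ∑ i ∈ T, a₁ i ≤ (1 + 4 * γ / (3 / 10)) * V :=
    h1.trans (mul_le_mul_of_nonneg_left (by linarith) (by positivity))
  have h10 : ∑ i ∈ T, a₂ i ≤ (1 + 4 * γ / (1 / 2)) * V :=
    h2.trans (mul_le_mul_of_nonneg_left (by linarith) (by positivity))
  have hV : 0 ≤ V := le_trans (Finset.sum_nonneg fun i hi =>
    hu i (mem_range.mp (hS₁.subset hi))) h7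
  rw [hsum]
  -- The factor is `2 + (40/3 + 8) γ`, and `2 ≤ 2γ`.
  have : (1 + 4 * γ / (3 / 10) + (1 + 4 * γ / (1 / 2))) * V ≤ 25 * γ * V :=
    mul_le_mul_of_nonneg_right (by linarith) hV
  linarith

end Layering

/-! ### Total correctness with a time bound -/

/-- Program `p`, started in `σ`, halts after at most `c` steps in a state with property `Q`. -/
def Runs (p : Prog) (σ : State) (c : ℕ) (Q : State → Prop) : Prop :=
  ∃ σ' c', Exec p σ σ' c' ∧ c' ≤ c ∧ Q σ'

theorem Runs.mono {p : Prog} {σ : State} {c d : ℕ} {Q R : State → Prop} (h : Runs p σ c Q)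
    (hcd : c ≤ d) (hQR : ∀ σ', Q σ' → R σ') : Runs p σ d R := by
  obtain ⟨σ', c', he, hc, hQ⟩ := h
  exact ⟨σ', c', he, hc.trans hcd, hQR σ' hQ⟩

theorem Runs.seq {p q : Prog} {σ : State} {c d : ℕ} {Q R : State → Prop} (hp : Runs p σ c R)
    (hq : ∀ σ', R σ' → Runs q σ' d Q) : Runs (.seq p q) σ (c + d) Q := by
  obtain ⟨σ', c', he, hc, hR⟩ := hp
  obtain ⟨σ'', d', he', hd, hQ⟩ := hq σ' hR
  exact ⟨σ'', c' + d', .seq he he', add_le_add hc hd, hQ⟩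

/-- Programs without loops. -/
def Prog.IsLine : Prog → Prop
  | .skip => True
  | .setNat _ _ _ => True
  | .setReal _ _ _ => True
  | .seq p q => p.IsLine ∧ q.IsLine
  | .cond _ p q => p.IsLine ∧ q.IsLine
  | .loop _ _ => False

open Classical in
/-- The effect of a program without loops. -/
def Prog.effect : Prog → State → State
  | .skip, σ => σ
  | .setNat a i e, σ => σ.writeNat a (i.eval σ) (e.eval σ)
  | .setReal a i e, σ => σ.writeReal a (i.eval σ) (e.eval σ)
  | .seq p q, σ => q.effect (p.effect σ)
  | .cond b p q, σ => if b.eval σ then p.effect σ else q.effect σ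
  | .loop _ _, σ => σ

/-- A time bound for programs without loops. -/
def Prog.lineCost : Prog → ℕ
  | .skip => 1
  | .setNat _ i e => i.cost + e.cost + 1
  | .setReal _ i e => i.cost + e.cost + 1
  | .seq p q => p.lineCost + q.lineCost
  -- The sum of the costs of both branches serves as a bound for either one.
  | .cond b p q => b.cost + (p.lineCost + q.lineCost) + 1
  | .loop _ _ => 0

theorem Prog.IsLine.runs {p : Prog} (hp : p.IsLine) (σ : State) :
    Runs p σ p.lineCost (fun σ' => σ' = p.effect σ) := by
  induction p generalizing σ with
  | skip => exact ⟨_, _, .skip σ, le_rfl, rfl⟩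
  | setNat a i e => exact ⟨_, _, .setNat a i e σ, le_rfl, rfl⟩
  | setReal a i e => exact ⟨_, _, .setReal a i e σ, le_rfl, rfl⟩
  | seq p q ihp ihq =>
    refine (ihp hp.1 σ).seq (d := q.lineCost) fun σ' h => ?_
    subst h
    exact ihq hp.2 _
  | cond b p q ihp ihq =>
    by_cases hb : b.eval σ
    · obtain ⟨σ', c, he, hc, h⟩ := ihp hp.1 σ
      refine ⟨σ', _, .condTrue hb he, ?_, ?_⟩
      · simp only [Prog.lineCost]; omega
      · rw [h, Prog.effect, if_pos hb]
    · obtain ⟨σ', c, he, hc, h⟩ := ihq hp.2 σ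
      refine ⟨σ', _, .condFalse hb he, ?_, ?_⟩
      · simp only [Prog.lineCost]; omega
      · rw [h, Prog.effect, if_neg hb]
  | loop b p => exact hp.elim

theorem Runs.line {p : Prog} (hp : p.IsLine) {σ : State} {c : ℕ} {Q : State → Prop}
    (hc : p.lineCost ≤ c) (hQ : Q (p.effect σ)) : Runs p σ c Q :=
  (hp.runs σ).mono hc fun _ h => h ▸ hQ

/-- `for` the counter in cell `0` of natural array `a` from `0` up to the content of cell `t` of
natural array `b`. -/
def forLoop (a b t : ℕ) (p : Prog) : Prog :=
  .seq (.setNat a (.const 0) (.const 0))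
    (.loop (.natLe (.succ (.read a (.const 0))) (.read b (.const t)))
      (.seq p (.setNat a (.const 0) (.succ (.read a (.const 0))))))

/-- The invariant has to determine the counter and the bound, which excludes that the body destroys
them. One round costs `c` plus `6` for the test, `5` for the increment and `1` for the loop; the
`10` pays for the initialization and the last test. -/
theorem Runs.forLoop {a b t N c : ℕ} {p : Prog} {σ : State} {Q : State → Prop}
    (Inv : ℕ → State → Prop) (h0 : Inv 0 (σ.writeNat a 0 0))
    (ha : ∀ k ≤ N, ∀ σ, Inv k σ → σ.nat a 0 = k) (hb : ∀ k ≤ N, ∀ σ, Inv k σ → σ.nat b t = N)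
    (hp : ∀ k < N, ∀ σ, Inv k σ →
      Runs p σ c (fun σ' => Inv (k + 1) (σ'.writeNat a 0 (σ'.nat a 0 + 1))))
    (hQ : ∀ σ, Inv N σ → Q σ) : Runs (forLoop a b t p) σ (N * (c + 12) + 10) Q := by
  have key : ∀ r k, k + r = N → ∀ σ, Inv k σ →
      Runs (.loop (.natLe (.succ (.read a (.const 0))) (.read b (.const t)))
      (.seq p (.setNat a (.const 0) (.succ (.read a (.const 0)))))) σ (r * (c + 12) + 7) Q := by
    intro r
    induction r with
    | zero =>
      intro k hk σ hσ
      obtain rfl : k = N := by omega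
      refine ⟨σ, _, .loopFalse ?_, ?_, hQ σ hσ⟩
      · have h1 := ha k le_rfl σ hσ
        have h2 := hb k le_rfl σ hσ
        simp [Test.eval, NatExpr.eval, h1, h2]
      · simp [Test.cost, NatExpr.cost]
    | succ r ih =>
      intro k hk σ hσ
      obtain ⟨σ', c', he, hc', hinv⟩ := hp k (by omega) σ hσ
      obtain ⟨σ'', d, hl, hd, hQ'⟩ := ih (k + 1) (by omega) _ hinv
      refine ⟨σ'', _, .loopTrue ?_ (.seq he (.setNat a (.const 0) _ σ')) hl, ?_, hQ'⟩
      · have h1 := ha k (by omega) σ hσ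
        have h2 := hb k (by omega) σ hσ
        simp only [Test.eval, NatExpr.eval, h1, h2]
        omega
      · simp only [Test.cost, NatExpr.cost]
        rw [Nat.succ_mul]
        omega
  obtain ⟨σ', c', he, hc, hQ'⟩ := key N 0 (by omega) _ h0
  refine ⟨σ', _, .seq (.setNat a (.const 0) (.const 0) σ) he, ?_, hQ'⟩
  simp only [NatExpr.cost]
  omega

/-! ### The memory layout -/

/-- The contents of the memory, by the names of the arrays and variables. -/
structure Mem where
  size : ℕ → ℕ
  user : ℕ → ℕ
  first : ℕ → ℕ
  last : ℕ → ℕ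
  out : ℕ → ℕ
  saved : ℕ → ℕ
  mark : ℕ → ℕ
  rep : ℕ → ℕ
  crit : ℕ → ℕ
  ord : ℕ → ℕ
  numRep : ℕ
  i : ℕ
  j : ℕ
  k : ℕ
  pos : ℕ
  cap : ℕ → ℝ
  re : ℕ → ℝ
  im : ℕ → ℝ
  util : ℕ → ℝ
  norm : ℕ → ℝ
  bot : ℕ → ℝ
  anchor : ℕ → ℝ
  gain : ℕ → ℝ
  weight : ℕ → ℝ
  top : ℝ
  acc : ℝ
  val : ℝ
  savedVal : ℝ

/-- An array that holds `v` in cell `0`, and `0` elsewhere. -/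
def cell {α : Type} [Zero α] (v : α) : ℕ → α := fun t => if t = 0 then v else 0

theorem update_cell {α : Type} [Zero α] (v w : α) : update (cell v) 0 w = cell w := by
  funext t
  by_cases h : t = 0
  · subst h; simp [cell]
  · simp [cell, h]

namespace Mem

def toState (μ : Mem) : State where
  nat
    | 0 => μ.size
    | 1 => μ.user
    | 2 => μ.first
    | 3 => μ.last
    | 4 => μ.out
    | 5 => μ.saved
    | 6 => μ.mark
    | 7 => μ.rep
    | 8 => μ.crit
    | 9 => μ.ord
    | 10 => cell μ.numRep
    | 11 => cell μ.i
    | 12 => cell μ.j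
    | 13 => cell μ.k
    | 14 => cell μ.pos
    | _ => fun _ => 0
  real
    | 0 => μ.cap
    | 1 => μ.re
    | 2 => μ.im
    | 3 => μ.util
    | 4 => μ.norm
    | 5 => μ.bot
    | 6 => μ.anchor
    | 7 => μ.gain
    | 8 => μ.weight
    | 9 => cell μ.top
    | 10 => cell μ.acc
    | 11 => cell μ.val
    | 12 => cell μ.savedVal
    | _ => fun _ => 0

variable (μ : Mem) (x v : ℕ) (r : ℝ)

@[simp] theorem nat_size : μ.toState.nat 0 x = μ.size x := rfl
@[simp] theorem nat_user : μ.toState.nat 1 x = μ.user x := rfl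
@[simp] theorem nat_first : μ.toState.nat 2 x = μ.first x := rfl
@[simp] theorem nat_last : μ.toState.nat 3 x = μ.last x := rfl
@[simp] theorem nat_out : μ.toState.nat 4 x = μ.out x := rfl
@[simp] theorem nat_saved : μ.toState.nat 5 x = μ.saved x := rfl
@[simp] theorem nat_mark : μ.toState.nat 6 x = μ.mark x := rfl
@[simp] theorem nat_rep : μ.toState.nat 7 x = μ.rep x := rfl
@[simp] theorem nat_crit : μ.toState.nat 8 x = μ.crit x := rfl
@[simp] theorem nat_ord : μ.toState.nat 9 x = μ.ord x := rfl
@[simp] theorem nat_numRep : μ.toState.nat 10 0 = μ.numRep := rfl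
@[simp] theorem nat_i : μ.toState.nat 11 0 = μ.i := rfl
@[simp] theorem nat_j : μ.toState.nat 12 0 = μ.j := rfl
@[simp] theorem nat_k : μ.toState.nat 13 0 = μ.k := rfl
@[simp] theorem nat_pos : μ.toState.nat 14 0 = μ.pos := rfl
@[simp] theorem real_cap : μ.toState.real 0 x = μ.cap x := rfl
@[simp] theorem real_re : μ.toState.real 1 x = μ.re x := rfl
@[simp] theorem real_im : μ.toState.real 2 x = μ.im x := rfl
@[simp] theorem real_util : μ.toState.real 3 x = μ.util x := rfl
@[simp] theorem real_norm : μ.toState.real 4 x = μ.norm x := rfl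
@[simp] theorem real_bot : μ.toState.real 5 x = μ.bot x := rfl
@[simp] theorem real_anchor : μ.toState.real 6 x = μ.anchor x := rfl
@[simp] theorem real_gain : μ.toState.real 7 x = μ.gain x := rfl
@[simp] theorem real_weight : μ.toState.real 8 x = μ.weight x := rfl
@[simp] theorem real_top : μ.toState.real 9 0 = μ.top := rfl
@[simp] theorem real_acc : μ.toState.real 10 0 = μ.acc := rfl
@[simp] theorem real_val : μ.toState.real 11 0 = μ.val := rfl
@[simp] theorem real_savedVal : μ.toState.real 12 0 = μ.savedVal := rfl

/-- This turns a write to the machine memory into an update of one field of the record, so that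
loop-free code can be executed symbolically by `simp`. -/
theorem writeNat_eq {μ μ' : Mem} {a x v : ℕ} (ha : a < 15)
    (h : update (μ.toState.nat a) x v = μ'.toState.nat a)
    (h' : ∀ b < 15, b ≠ a → μ.toState.nat b = μ'.toState.nat b)
    (hr : μ.toState.real = μ'.toState.real) : μ.toState.writeNat a x v = μ'.toState := by
  have : update μ.toState.nat a (update (μ.toState.nat a) x v) = μ'.toState.nat := by
    funext b
    by_cases hb : b = a
    · subst hb; rw [update_self, h]
    · rw [update_of_ne hb]
      by_cases hb' : b < 15
      · exact h' b hb' hb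
      · obtain ⟨t, rfl⟩ := Nat.exists_eq_add_of_le' (not_lt.mp hb')
        rfl
  unfold State.writeNat
  rw [this, hr]

theorem writeReal_eq {μ μ' : Mem} {a x : ℕ} {v : ℝ} (ha : a < 13)
    (h : update (μ.toState.real a) x v = μ'.toState.real a)
    (h' : ∀ b < 13, b ≠ a → μ.toState.real b = μ'.toState.real b)
    (hr : μ.toState.nat = μ'.toState.nat) : μ.toState.writeReal a x v = μ'.toState := by
  have : update μ.toState.real a (update (μ.toState.real a) x v) = μ'.toState.real := by
    funext b
    by_cases hb : b = a
    · subst hb; rw [update_self, h]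
    · rw [update_of_ne hb]
      by_cases hb' : b < 13
      · exact h' b hb' hb
      · obtain ⟨t, rfl⟩ := Nat.exists_eq_add_of_le' (not_lt.mp hb')
        rfl
  unfold State.writeReal
  rw [this, hr]

@[simp] theorem write_out :
    μ.toState.writeNat 4 x v = toState { μ with out := update μ.out x v } :=
  writeNat_eq (by decide) rfl (by
    intro b hb hb'; interval_cases b <;> first | rfl | exact absurd rfl hb') rfl

@[simp] theorem write_saved :
    μ.toState.writeNat 5 x v = toState { μ with saved := update μ.saved x v } :=
  writeNat_eq (by decide) rfl (by
    intro b hb hb'; interval_cases b <;> first | rfl | exact absurd rfl hb') rfl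

@[simp] theorem write_mark :
    μ.toState.writeNat 6 x v = toState { μ with mark := update μ.mark x v } :=
  writeNat_eq (by decide) rfl (by
    intro b hb hb'; interval_cases b <;> first | rfl | exact absurd rfl hb') rfl

@[simp] theorem write_rep :
    μ.toState.writeNat 7 x v = toState { μ with rep := update μ.rep x v } :=
  writeNat_eq (by decide) rfl (by
    intro b hb hb'; interval_cases b <;> first | rfl | exact absurd rfl hb') rfl

@[simp] theorem write_crit :
    μ.toState.writeNat 8 x v = toState { μ with crit := update μ.crit x v } :=
  writeNat_eq (by decide) rfl (by
    intro b hb hb'; interval_cases b <;> first | rfl | exact absurd rfl hb') rfl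

@[simp] theorem write_ord :
    μ.toState.writeNat 9 x v = toState { μ with ord := update μ.ord x v } :=
  writeNat_eq (by decide) rfl (by
    intro b hb hb'; interval_cases b <;> first | rfl | exact absurd rfl hb') rfl

@[simp] theorem write_numRep :
    μ.toState.writeNat 10 0 v = toState { μ with numRep := v } :=
  writeNat_eq (by decide) (update_cell _ _) (by
    intro b hb hb'; interval_cases b <;> first | rfl | exact absurd rfl hb') rfl

@[simp] theorem write_i :
    μ.toState.writeNat 11 0 v = toState { μ with i := v } :=
  writeNat_eq (by decide) (update_cell _ _) (by
    intro b hb hb'; interval_cases b <;> first | rfl | exact absurd rfl hb') rfl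

@[simp] theorem write_j :
    μ.toState.writeNat 12 0 v = toState { μ with j := v } :=
  writeNat_eq (by decide) (update_cell _ _) (by
    intro b hb hb'; interval_cases b <;> first | rfl | exact absurd rfl hb') rfl

@[simp] theorem write_k :
    μ.toState.writeNat 13 0 v = toState { μ with k := v } :=
  writeNat_eq (by decide) (update_cell _ _) (by
    intro b hb hb'; interval_cases b <;> first | rfl | exact absurd rfl hb') rfl

@[simp] theorem write_pos :
    μ.toState.writeNat 14 0 v = toState { μ with pos := v } :=
  writeNat_eq (by decide) (update_cell _ _) (by
    intro b hb hb'; interval_cases b <;> first | rfl | exact absurd rfl hb') rfl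

@[simp] theorem write_norm :
    μ.toState.writeReal 4 x r = toState { μ with norm := update μ.norm x r } :=
  writeReal_eq (by decide) rfl (by
    intro b hb hb'; interval_cases b <;> first | rfl | exact absurd rfl hb') rfl

@[simp] theorem write_bot :
    μ.toState.writeReal 5 x r = toState { μ with bot := update μ.bot x r } :=
  writeReal_eq (by decide) rfl (by
    intro b hb hb'; interval_cases b <;> first | rfl | exact absurd rfl hb') rfl

@[simp] theorem write_anchor :
    μ.toState.writeReal 6 x r = toState { μ with anchor := update μ.anchor x r } :=
  writeReal_eq (by decide) rfl (by
    intro b hb hb'; interval_cases b <;> first | rfl | exact absurd rfl hb') rfl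

@[simp] theorem write_gain :
    μ.toState.writeReal 7 x r = toState { μ with gain := update μ.gain x r } :=
  writeReal_eq (by decide) rfl (by
    intro b hb hb'; interval_cases b <;> first | rfl | exact absurd rfl hb') rfl

@[simp] theorem write_weight :
    μ.toState.writeReal 8 x r = toState { μ with weight := update μ.weight x r } :=
  writeReal_eq (by decide) rfl (by
    intro b hb hb'; interval_cases b <;> first | rfl | exact absurd rfl hb') rfl

@[simp] theorem write_top :
    μ.toState.writeReal 9 0 r = toState { μ with top := r } :=
  writeReal_eq (by decide) (update_cell _ _) (by
    intro b hb hb'; interval_cases b <;> first | rfl | exact absurd rfl hb') rfl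

@[simp] theorem write_acc :
    μ.toState.writeReal 10 0 r = toState { μ with acc := r } :=
  writeReal_eq (by decide) (update_cell _ _) (by
    intro b hb hb'; interval_cases b <;> first | rfl | exact absurd rfl hb') rfl

@[simp] theorem write_val :
    μ.toState.writeReal 11 0 r = toState { μ with val := r } :=
  writeReal_eq (by decide) (update_cell _ _) (by
    intro b hb hb'; interval_cases b <;> first | rfl | exact absurd rfl hb') rfl

@[simp] theorem write_savedVal :
    μ.toState.writeReal 12 0 r = toState { μ with savedVal := r } :=
  writeReal_eq (by decide) (update_cell _ _) (by
    intro b hb hb'; interval_cases b <;> first | rfl | exact absurd rfl hb') rfl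

end Mem

/-- The initial memory on an instance. -/
def Instance.mem (I : Instance) : Mem where
  size := toArray ![I.n, I.m, I.N]
  user := toArray fun i => (I.user i : ℕ)
  first := toArray fun i => (I.first i : ℕ)
  last := toArray fun i => (I.last i : ℕ)
  out := 0
  saved := 0
  mark := 0
  rep := 0
  crit := 0
  ord := 0
  numRep := 0
  i := 0
  j := 0
  k := 0
  pos := 0
  cap := toArray I.cap
  re := toArray fun i => (I.demand i).re
  im := toArray fun i => (I.demand i).im
  util := toArray I.utility
  norm := 0
  bot := 0
  anchor := 0
  gain := 0
  weight := 0
  top := 0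
  acc := 0
  val := 0
  savedVal := 0

theorem cell_zero {α : Type} [Zero α] : cell (0 : α) = fun _ => 0 := by
  funext t; simp [cell]

theorem Instance.input_eq (I : Instance) : I.input = I.mem.toState := by
  have hn : I.input.nat = I.mem.toState.nat := by
    funext b
    by_cases hb : b < 15
    · interval_cases b <;> first | rfl | exact cell_zero.symm
    · obtain ⟨t, rfl⟩ := Nat.exists_eq_add_of_le' (not_lt.mp hb)
      rfl
  have hr : I.input.real = I.mem.toState.real := by
    funext b
    by_cases hb : b < 13
    · interval_cases b <;> first | rfl | exact cell_zero.symm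
    · obtain ⟨t, rfl⟩ := Nat.exists_eq_add_of_le' (not_lt.mp hb)
      rfl
  rcases h : I.input with ⟨a, b⟩
  rw [h] at hn hr
  rcases h' : I.mem.toState with ⟨a', b'⟩
  rw [h'] at hn hr
  simp only at hn hr
  rw [hn, hr]

/-! ### The program -/

namespace NatExpr

abbrev user (e : NatExpr) : NatExpr := .read 1 e
abbrev first (e : NatExpr) : NatExpr := .read 2 e
abbrev last (e : NatExpr) : NatExpr := .read 3 e
abbrev out (e : NatExpr) : NatExpr := .read 4 e
abbrev mark (e : NatExpr) : NatExpr := .read 6 e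
abbrev rep (e : NatExpr) : NatExpr := .read 7 e
abbrev crit (e : NatExpr) : NatExpr := .read 8 e
abbrev ord (e : NatExpr) : NatExpr := .read 9 e
abbrev numRep : NatExpr := .read 10 (.const 0)
abbrev i : NatExpr := .read 11 (.const 0)
abbrev j : NatExpr := .read 12 (.const 0)
abbrev k : NatExpr := .read 13 (.const 0)
abbrev pos : NatExpr := .read 14 (.const 0)

end NatExpr

namespace RealExpr

abbrev cap (e : NatExpr) : RealExpr := .read 0 e
abbrev re (e : NatExpr) : RealExpr := .read 1 e
abbrev im (e : NatExpr) : RealExpr := .read 2 e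
abbrev util (e : NatExpr) : RealExpr := .read 3 e
abbrev norm (e : NatExpr) : RealExpr := .read 4 e
abbrev bot (e : NatExpr) : RealExpr := .read 5 e
abbrev anchor (e : NatExpr) : RealExpr := .read 6 e
abbrev gain (e : NatExpr) : RealExpr := .read 7 e
abbrev weight (e : NatExpr) : RealExpr := .read 8 e
abbrev top : RealExpr := .read 9 (.const 0)
abbrev acc : RealExpr := .read 10 (.const 0)
abbrev val : RealExpr := .read 11 (.const 0)
abbrev savedVal : RealExpr := .read 12 (.const 0)

end RealExpr

namespace Prog

open NatExpr RealExpr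

/-- Compute the absolute values of the demands and their maximum, and mark the slots at which the
set of active demands changes. -/
def measure : Prog :=
  .seq (.setNat 6 (.const 0) (.const 1))
    (forLoop 11 0 0
      (.seq (.setNat 6 (.first .i) (.const 1))
        (.seq (.setNat 6 (.succ (.last .i)) (.const 1))
          (.seq (.setReal 4 .i (.sqrt (.add (.mul (.re .i) (.re .i)) (.mul (.im .i) (.im .i)))))
            (.cond (.realLe (.norm .i) .top) .skip (.setReal 9 (.const 0) (.norm .i)))))))

/-- Find a slot of minimum capacity between any two consecutive marks. -/
def scan : Prog :=
  forLoop 11 0 1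
    (.cond (.natLe (.const 1) (.mark .i))
      (.seq (.setNat 7 .numRep .i) (.setNat 10 (.const 0) (.succ .numRep)))
      (.cond (.realLe (.cap .i) (.cap (.rep (.pred .numRep))))
        (.setNat 7 (.pred .numRep) .i) .skip))

/-- Compute the minimum capacity in the interval of each demand. -/
def bottlenecks : Prog :=
  forLoop 11 0 0
    (.seq (.setReal 5 .i (.cap (.first .i)))
      (forLoop 12 10 0
        (.cond (.and (.natLe (.first .i) (.rep .j)) (.and (.natLe (.rep .j) (.last .i))
            (.realLe (.cap (.rep .j)) (.bot .i))))
          (.setReal 5 .i (.cap (.rep .j))) .skip)))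

/-- List the demands in increasing order of a key; the tests compare the keys of `.j` and `.i`,
and of `.i` and `.j`. -/
def sortBy (ji ij : Test) : Prog :=
  forLoop 11 0 0
    (.seq (.setNat 14 (.const 0) (.const 0))
      (.seq
        (forLoop 12 0 0
          (.cond (.and ji (.neg (.and ij (.natLe .i .j))))
            (.setNat 14 (.const 0) (.succ .pos)) .skip))
        (.setNat 9 .pos .i)))

/-- Group the demands, listed by their bottlenecks, into layers. -/
def anchors : Prog :=
  .seq (.setReal 10 (.const 0) .top)
    (forLoop 13 0 0
      (.seq
        (.cond (.realLe (.bot (.ord .k)) (.mul (.const 4) .acc)) .skip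
          (.setReal 10 (.const 0) (.bot (.ord .k))))
        (.setReal 6 (.ord .k) .acc)))

/-- Find the last low slot of each demand. -/
def crits : Prog :=
  forLoop 11 0 0
    (forLoop 12 10 0
      (.cond (.and (.natLe (.first .i) (.rep .j)) (.and (.natLe (.rep .j) (.last .i))
          (.and (.realLe (.cap (.rep .j)) (.mul (.const 4) (.anchor .i)))
            (.natLe (.crit .i) (.rep .j)))))
        (.setNat 8 .i (.rep .j)) .skip))

/-- Initialize a run of the local ratio method for the demands that pass the test. -/
def start (active : Test) : Prog :=
  .seq (.setReal 11 (.const 0) (.const 0))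
    (forLoop 11 0 0
      (.seq (.setNat 4 .i (.const 0))
        (.seq (.setReal 7 .i (.const 0))
          (.cond active (.setReal 8 .i (.util .i)) (.setReal 8 .i (.const 0))))))

/-- Does demand `f` obstruct the last low slot of demand `e`? -/
def meets (e f : NatExpr) : Test :=
  .and (.and (.realLe (.anchor e) (.anchor f)) (.realLe (.anchor f) (.anchor e)))
    (.and (.natLe (.first f) (.crit e)) (.natLe (.crit e) (.last f)))

def sameUser (e f : NatExpr) : Test :=
  .and (.natLe (.user e) (.user f)) (.natLe (.user f) (.user e))

/-- The first phase of the local ratio method. -/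
def raise (κ : ℚ) : Prog :=
  forLoop 13 0 0
    (.seq (.setNat 11 (.const 0) (.ord .k))
      (.seq (.setReal 10 (.const 0) (.weight .i))
        (.seq
          (forLoop 12 0 0
            (.seq
              (.cond (sameUser .j .i) (.setReal 10 (.const 0) (.sub .acc (.gain .j))) .skip)
              (.cond (meets .j .i)
                (.setReal 10 (.const 0) (.sub .acc (.mul (.gain .j)
                  (.div (.norm .i) (.mul (.const κ) (.anchor .j)))))) .skip)))
          (.cond (.realLe (.const 0) .acc) (.setReal 7 .i .acc) .skip))))

/-- The second phase of the local ratio method. -/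
def select (κ : ℚ) : Prog :=
  .seq (.setNat 14 (.const 0) (.read 0 (.const 0)))
    (forLoop 13 0 0
      (.seq (.setNat 14 (.const 0) (.pred .pos))
        (.seq (.setNat 11 (.const 0) (.ord .pos))
          (.seq (.setReal 10 (.const 0) (.const 0))
            (.seq
              (forLoop 12 0 0
                (.cond (.natLe (.const 1) (.out .j))
                  (.seq
                    (.cond (sameUser .i .j) (.setReal 10 (.const 0) (.add .acc (.const 1))) .skip)
                    (.cond (meets .i .j)
                      (.setReal 10 (.const 0) (.add .acc
                        (.div (.norm .j) (.mul (.const κ) (.anchor .i))))) .skip))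
                  .skip))
              (.cond (.and (.neg (.realLe (.const 1) .acc)) (.neg (.realLe (.gain .i) (.const 0))))
                (.seq (.setNat 4 .i (.const 1))
                  (.setReal 11 (.const 0) (.add .val (.util .i)))) .skip))))))

/-- Keep a copy of the current selection. -/
def save : Prog :=
  .seq (.setReal 12 (.const 0) .val)
    (forLoop 11 0 0 (.setNat 5 .i (.out .i)))

/-- Return to the copy if it is better. -/
def better : Prog :=
  .cond (.realLe .savedVal .val) .skip
    (forLoop 11 0 0 (.setNat 4 .i (.read 5 .i)))

/-- Is demand `.i` large? -/
def largeTest : Test :=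
  .and (.and (.realLe (.anchor .i) .top) (.realLe .top (.anchor .i)))
    (.neg (.realLe (.mul (.const 2) (.norm .i)) .top))

def localRatio (κ : ℚ) (active : Test) : Prog :=
  .seq (start active) (.seq (raise κ) (select κ))

def layers : Prog :=
  .seq measure (.seq scan (.seq bottlenecks
    (.seq (sortBy (.realLe (.bot .j) (.bot .i)) (.realLe (.bot .i) (.bot .j)))
      (.seq anchors (.seq crits
        (sortBy (.natLe (.last .j) (.last .i)) (.natLe (.last .i) (.last .j))))))))

/-- The approximation algorithm. -/
def schedule : Prog :=
  .seq layers (.seq (localRatio (3 / 10) (.neg largeTest)) (.seq save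
    (.seq (localRatio (1 / 2) largeTest) better)))

end Prog

theorem Runs.cond {b : Test} {p q : Prog} {σ : State} {c : ℕ} {Q : State → Prop}
    (hp : b.eval σ → Runs p σ c Q) (hq : ¬ b.eval σ → Runs q σ c Q) :
    Runs (.cond b p q) σ (b.cost + c + 1) Q := by
  by_cases hb : b.eval σ
  · obtain ⟨σ', c', he, hc, h⟩ := hp hb
    exact ⟨σ', _, .condTrue hb he, by omega, h⟩
  · obtain ⟨σ', c', he, hc, h⟩ := hq hb
    exact ⟨σ', _, .condFalse hb he, by omega, h⟩

/-! ### Correctness of the parts of the program -/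

/-- The slots at which the set of active demands may change. -/
def IsBoundary (n : ℕ) (first last : ℕ → ℕ) (t : ℕ) : Prop :=
  t = 0 ∨ ∃ i < n, t = first i ∨ t = last i + 1

/-- Slot `0` always counts as a boundary, so the scan opens a representative before it compares with
one. By `top_le` the value `top` is the least nonnegative bound, through which the no-bottleneck
assumption reaches `top`; it is `0` without demands. -/
structure Measured (n : ℕ) (first last mark : ℕ → ℕ) (re im norm : ℕ → ℝ) (top : ℝ) : Prop where
  mark_iff : ∀ t, 1 ≤ mark t ↔ IsBoundary n first last t
  norm_eq : ∀ i < n, norm i = √(re i * re i + im i * im i)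
  norm_le : ∀ i < n, norm i ≤ top
  top_nonneg : 0 ≤ top
  top_le : ∀ C, 0 ≤ C → (∀ i < n, norm i ≤ C) → top ≤ C

theorem Measured.zero (first last : ℕ → ℕ) (re im norm : ℕ → ℝ) :
    Measured 0 first last (update 0 0 1) re im norm 0 where
  mark_iff t := by
    by_cases h : t = 0 <;> simp [IsBoundary, h]
  norm_eq i hi := absurd hi (Nat.not_lt_zero i)
  norm_le i hi := absurd hi (Nat.not_lt_zero i)
  top_nonneg := le_rfl
  top_le C hC _ := hC

theorem Measured.succ {k : ℕ} {first last mark : ℕ → ℕ} {re im norm : ℕ → ℝ} {top : ℝ}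
    (h : Measured k first last mark re im norm top) :
    Measured (k + 1) first last (update (update mark (first k) 1) (last k + 1) 1) re im
      (update norm k (√(re k * re k + im k * im k)))
      (max top (√(re k * re k + im k * im k))) where
  mark_iff t := by
    have := h.mark_iff t
    unfold IsBoundary at this ⊢
    simp only [Nat.lt_succ_iff_lt_or_eq, or_and_right, exists_or, exists_eq_left]
    by_cases h1 : t = last k + 1
    · subst h1; simp
    · by_cases h2 : t = first k
      · subst h2; rw [update_of_ne h1, update_self]; simp
      · rw [update_of_ne h1, update_of_ne h2, this]
        simp [h1, h2]
  norm_eq i hi := by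
    rcases Nat.lt_succ_iff_lt_or_eq.mp hi with hi | rfl
    · rw [update_of_ne hi.ne, h.norm_eq i hi]
    · rw [update_self]
  norm_le i hi := by
    rcases Nat.lt_succ_iff_lt_or_eq.mp hi with hi | rfl
    · rw [update_of_ne hi.ne]; exact (h.norm_le i hi).trans (le_max_left _ _)
    · rw [update_self]; exact le_max_right _ _
  top_nonneg := h.top_nonneg.trans (le_max_left _ _)
  top_le C hC hle := by
    refine max_le (h.top_le C hC fun i hi => ?_) ?_
    · have := hle i (hi.trans (Nat.lt_succ_self k))
      rwa [update_of_ne hi.ne] at this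
    · have := hle k (Nat.lt_succ_self k)
      rwa [update_self] at this

namespace Mem

variable (μ : Mem)

theorem runs_measure (hmark : μ.mark = 0) (htop : μ.top = 0) :
    Runs Prog.measure μ.toState (60 * μ.size 0 + 13) fun σ => ∃ i mark norm top,
      σ = toState { μ with i := i, mark := mark, norm := norm, top := top } ∧
      Measured (μ.size 0) μ.first μ.last mark μ.re μ.im norm top := by
  refine Runs.mono (c := 3 + (μ.size 0 * (48 + 12) + 10)) ?_ (by omega) fun _ h => h
  refine Runs.seq (Runs.line (Q := fun σ => σ = toState { μ with mark := update 0 0 1 })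
    (by simp [Prog.IsLine]) le_rfl ?_) ?_
  · simp [Prog.effect, NatExpr.eval, hmark]
  rintro _ rfl
  refine Runs.forLoop (fun k σ => ∃ mark norm top,
      σ = toState { μ with i := k, mark := mark, norm := norm, top := top } ∧
      Measured k μ.first μ.last mark μ.re μ.im norm top) ?_ ?_ ?_ ?_ ?_
  · exact ⟨_, _, _, by rw [write_i, htop], Measured.zero _ _ _ _ _⟩
  · rintro k - _ ⟨mark, norm, top, rfl, -⟩; rfl
  · rintro k - _ ⟨mark, norm, top, rfl, -⟩; rfl
  · rintro k hk _ ⟨mark, norm, top, rfl, h⟩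
    refine Runs.line (by simp [Prog.IsLine])
      (by simp [Prog.lineCost, NatExpr.cost, RealExpr.cost, Test.cost]) ?_
    refine ⟨_, _, _, ?_, h.succ⟩
    rcases le_total (√(μ.re k * μ.re k + μ.im k * μ.im k)) top with hle | hle
    · simp [Prog.effect, NatExpr.eval, RealExpr.eval, Test.eval, hle]
    · rw [max_eq_right hle]
      by_cases hle' : √(μ.re k * μ.re k + μ.im k * μ.im k) ≤ top
      · simp [Prog.effect, NatExpr.eval, RealExpr.eval, Test.eval, le_antisymm hle hle']
      · simp [Prog.effect, NatExpr.eval, RealExpr.eval, Test.eval, hle']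
  · rintro _ ⟨mark, norm, top, rfl, h⟩
    exact ⟨_, _, _, _, rfl, h⟩

end Mem

/-! ### Compression of the slots to `O(n)` representatives. -/

/-- The slots `rep 0, …, rep (M - 1)` dominate all slots below `t`: each of these has a
representative that is active for the same demands and has no larger capacity. -/
structure Scanned (n : ℕ) (first last : ℕ → ℕ) (cap : ℕ → ℝ) (rep : ℕ → ℕ) (M t : ℕ) : Prop where
  rep_lt : ∀ k < M, rep k < t
  dom : ∀ s < t, ∃ k < M, cap (rep k) ≤ cap s ∧
    ∀ i < n, first i ≤ s → s ≤ last i → first i ≤ rep k ∧ rep k ≤ last i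
  card : M ≤ ({s ∈ range t | s ∈ insert 0 ((range n).image first ∪
    (range n).image fun i => last i + 1)} : Finset ℕ).card
  recent : 0 < t → 0 < M ∧ ∃ b ≤ rep (M - 1), (∀ s, b < s → s < t → ¬ IsBoundary n first last s) ∧
    ∀ s, b ≤ s → s < t → cap (rep (M - 1)) ≤ cap s

section Scanned

variable {n : ℕ} {first last : ℕ → ℕ} {cap : ℕ → ℝ} {rep : ℕ → ℕ} {M t : ℕ}

theorem Scanned.zero : Scanned n first last cap rep 0 0 where
  rep_lt k hk := absurd hk (Nat.not_lt_zero k)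
  dom s hs := absurd hs (Nat.not_lt_zero s)
  card := Nat.zero_le _
  recent h := absurd h (lt_irrefl 0)

/-- Representatives are opened only at boundaries, that is, at `0`, at starts, and one after ends.
This makes every later loop over slots a loop of length `O(n)`. -/
theorem Scanned.numRep_le (h : Scanned n first last cap rep M t) : M ≤ 2 * n + 1 := by
  refine h.card.trans ((Finset.card_le_card (t := insert 0 ((range n).image first ∪
    (range n).image fun i => last i + 1)) fun s hs => (mem_filter.mp hs).2).trans ?_)
  refine (Finset.card_insert_le _ _).trans ?_
  have h1 := Finset.card_union_le ((range n).image first) ((range n).image fun i => last i + 1)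
  have h2 := Finset.card_image_le (s := range n) (f := first)
  have h3 := Finset.card_image_le (s := range n) (f := fun i => last i + 1)
  rw [card_range] at h2 h3
  omega

theorem isBoundary_iff : IsBoundary n first last t ↔
    t ∈ insert 0 ((range n).image first ∪ (range n).image fun i => last i + 1) := by
  simp only [IsBoundary, mem_insert, mem_union, mem_image, mem_range]
  constructor
  · rintro (h | ⟨i, hi, h | h⟩)
    · exact Or.inl h
    · exact Or.inr (Or.inl ⟨i, hi, h.symm⟩)
    · exact Or.inr (Or.inr ⟨i, hi, h.symm⟩)
  · rintro (h | ⟨i, hi, h⟩ | ⟨i, hi, h⟩)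
    · exact Or.inl h
    · exact Or.inr ⟨i, hi, Or.inl h.symm⟩
    · exact Or.inr ⟨i, hi, Or.inr h.symm⟩

theorem Scanned.boundary (h : Scanned n first last cap rep M t)
    (hb : IsBoundary n first last t) :
    Scanned n first last cap (update rep M t) (M + 1) (t + 1) where
  rep_lt k hk := by
    rcases Nat.lt_succ_iff_lt_or_eq.mp hk with hk | rfl
    · rw [update_of_ne hk.ne]; exact (h.rep_lt k hk).trans (Nat.lt_succ_self t)
    · rw [update_self]; exact Nat.lt_succ_self t
  dom s hs := by
    rcases Nat.lt_succ_iff_lt_or_eq.mp hs with hs | rfl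
    · obtain ⟨k, hk, hd⟩ := h.dom s hs
      exact ⟨k, hk.trans (Nat.lt_succ_self M), by rwa [update_of_ne hk.ne]⟩
    · exact ⟨M, Nat.lt_succ_self M, by rw [update_self]; exact ⟨le_rfl, fun i _ h1 h2 => ⟨h1, h2⟩⟩⟩
  card := by
    rw [range_add_one, filter_insert, if_pos (isBoundary_iff.mp hb),
      card_insert_of_notMem (by simp)]
    exact Nat.succ_le_succ h.card
  recent _ := by
    refine ⟨Nat.succ_pos M, t, ?_, ?_, ?_⟩
    · rw [Nat.add_sub_cancel, update_self]
    · intro s h1 h2; omega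
    · intro s h1 h2
      obtain rfl : s = t := by omega
      rw [Nat.add_sub_cancel, update_self]

/-- A demand active at `t` cannot have started after the last boundary `b`, so it is already active
at the current representative, which lies in `[b, t)`. -/
theorem Scanned.inner (h : Scanned n first last cap rep M t)
    (hb : ¬ IsBoundary n first last t) (hc : ¬ cap t ≤ cap (rep (M - 1))) :
    Scanned n first last cap rep M (t + 1) := by
  have ht : 0 < t := Nat.pos_of_ne_zero fun h0 => hb (Or.inl h0)
  obtain ⟨hM, b, hbr, hnb, hmin⟩ := h.recent ht
  have hr := h.rep_lt (M - 1) (by omega)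
  refine ⟨fun k hk => (h.rep_lt k hk).trans (Nat.lt_succ_self t), ?_, ?_, fun _ => ⟨hM, b, hbr, ?_, ?_⟩⟩
  · intro s hs
    rcases Nat.lt_succ_iff_lt_or_eq.mp hs with hs | rfl
    · exact h.dom s hs
    · refine ⟨M - 1, by omega, (not_le.mp hc).le, fun i hi h1 h2 => ⟨?_, by omega⟩⟩
      by_contra hlt
      rcases h1.eq_or_lt with he | he
      · exact hb (Or.inr ⟨i, hi, Or.inl he.symm⟩)
      · exact hnb (first i) (by omega) he (Or.inr ⟨i, hi, Or.inl rfl⟩)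
  · rw [range_add_one, filter_insert, if_neg (fun hm => hb (isBoundary_iff.mpr hm))]
    exact h.card
  · intro s h1 h2
    rcases Nat.lt_succ_iff_lt_or_eq.mp h2 with h2 | rfl
    · exact hnb s h1 h2
    · exact hb
  · intro s h1 h2
    rcases Nat.lt_succ_iff_lt_or_eq.mp h2 with h2 | rfl
    · exact hmin s h1 h2
    · exact (not_le.mp hc).le

/-- A demand active at the old representative cannot have ended before `t`, since the slot after its
end would be a boundary. So the new representative `t` dominates whatever the old one did. -/
theorem Scanned.replace (h : Scanned n first last cap rep M t)
    (hb : ¬ IsBoundary n first last t) (hc : cap t ≤ cap (rep (M - 1))) :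
    Scanned n first last cap (update rep (M - 1) t) M (t + 1) := by
  have ht : 0 < t := Nat.pos_of_ne_zero fun h0 => hb (Or.inl h0)
  obtain ⟨hM, b, hbr, hnb, hmin⟩ := h.recent ht
  have hr := h.rep_lt (M - 1) (by omega)
  refine ⟨?_, ?_, ?_, fun _ => ⟨hM, b, ?_, ?_, ?_⟩⟩
  · intro k hk
    by_cases hkM : k = M - 1
    · subst hkM; rw [update_self]; exact Nat.lt_succ_self t
    · rw [update_of_ne hkM]; exact (h.rep_lt k hk).trans (Nat.lt_succ_self t)
  · intro s hs
    rcases Nat.lt_succ_iff_lt_or_eq.mp hs with hs | rfl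
    · obtain ⟨k, hk, hcap, hact⟩ := h.dom s hs
      by_cases hkM : k = M - 1
      · subst hkM
        refine ⟨M - 1, hk, ?_⟩
        rw [update_self]
        refine ⟨hc.trans hcap, fun i hi h1 h2 => ?_⟩
        obtain ⟨h3, h4⟩ := hact i hi h1 h2
        refine ⟨by omega, ?_⟩
        by_contra hlt
        by_cases he : last i + 1 = t
        · exact hb (Or.inr ⟨i, hi, Or.inr he.symm⟩)
        · exact hnb (last i + 1) (by omega) (by omega) (Or.inr ⟨i, hi, Or.inr rfl⟩)
      · exact ⟨k, hk, by rw [update_of_ne hkM]; exact ⟨hcap, hact⟩⟩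
    · exact ⟨M - 1, by omega, by rw [update_self]; exact ⟨le_rfl, fun i _ h1 h2 => ⟨h1, h2⟩⟩⟩
  · rw [range_add_one, filter_insert, if_neg (fun hm => hb (isBoundary_iff.mpr hm))]
    exact h.card
  · rw [update_self]; omega
  · intro s h1 h2
    rcases Nat.lt_succ_iff_lt_or_eq.mp h2 with h2 | rfl
    · exact hnb s h1 h2
    · exact hb
  · intro s h1 h2
    rw [update_self]
    rcases Nat.lt_succ_iff_lt_or_eq.mp h2 with h2 | rfl
    · exact hc.trans (hmin s h1 h2)
    · exact le_rfl

end Scanned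

namespace Mem

variable (μ : Mem)

theorem runs_scan {n : ℕ} (hmark : ∀ t, 1 ≤ μ.mark t ↔ IsBoundary n μ.first μ.last t)
    (hM : μ.numRep = 0) :
    Runs Prog.scan μ.toState (μ.size 1 * 60 + 10) fun σ => ∃ i rep M,
      σ = toState { μ with i := i, rep := rep, numRep := M } ∧
      Scanned n μ.first μ.last μ.cap rep M (μ.size 1) := by
  refine Runs.forLoop (N := μ.size 1) (c := 48) (fun k σ => ∃ rep M,
      σ = toState { μ with i := k, rep := rep, numRep := M } ∧
      Scanned n μ.first μ.last μ.cap rep M k) ?_ ?_ ?_ ?_ ?_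
  · exact ⟨μ.rep, 0, by rw [write_i, ← hM], Scanned.zero⟩
  · rintro k - _ ⟨rep, M, rfl, -⟩; rfl
  · rintro k - _ ⟨rep, M, rfl, -⟩; rfl
  · rintro k hk _ ⟨rep, M, rfl, h⟩
    refine Runs.line (by simp [Prog.IsLine])
      (by simp [Prog.lineCost, NatExpr.cost, RealExpr.cost, Test.cost]) ?_
    by_cases hb : 1 ≤ μ.mark k
    · refine ⟨_, _, ?_, h.boundary ((hmark k).mp hb)⟩
      simp [Prog.effect, NatExpr.eval, Test.eval, hb]
    · have hb' := fun hh => hb ((hmark k).mpr hh)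
      by_cases hc : μ.cap k ≤ μ.cap (rep (M - 1))
      · refine ⟨_, _, ?_, h.replace hb' hc⟩
        simp [Prog.effect, NatExpr.eval, RealExpr.eval, Test.eval, hb, hc]
      · refine ⟨_, _, ?_, h.inner hb' hc⟩
        simp [Prog.effect, NatExpr.eval, RealExpr.eval, Test.eval, hb, hc]
  · rintro _ ⟨rep, M, rfl, h⟩
    exact ⟨_, _, _, rfl, h⟩

/-- The value `b` is the capacity of a slot in `[first, last]`, and no larger than those of the
representatives in it. -/
def IsBottleneck (cap : ℕ → ℝ) (rep : ℕ → ℕ) (M first last : ℕ) (b : ℝ) : Prop :=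
  (∃ s, first ≤ s ∧ s ≤ last ∧ b = cap s) ∧
    ∀ k < M, first ≤ rep k → rep k ≤ last → b ≤ cap (rep k)

theorem runs_bottlenecks (hfl : ∀ i < μ.size 0, μ.first i ≤ μ.last i) :
    Runs Prog.bottlenecks μ.toState (μ.size 0 * ((8 + (μ.numRep * (38 + 12) + 10)) + 12) + 10)
      fun σ => ∃ i j bot, σ = toState { μ with i := i, j := j, bot := bot } ∧
      ∀ i < μ.size 0, IsBottleneck μ.cap μ.rep μ.numRep (μ.first i) (μ.last i) (bot i) := by
  refine Runs.forLoop (N := μ.size 0) (fun k σ => ∃ j bot,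
      σ = toState { μ with i := k, j := j, bot := bot } ∧
      ∀ i < k, IsBottleneck μ.cap μ.rep μ.numRep (μ.first i) (μ.last i) (bot i)) ?_ ?_ ?_ ?_ ?_
  · exact ⟨μ.j, μ.bot, by rw [write_i], fun i hi => absurd hi (Nat.not_lt_zero i)⟩
  · rintro k - _ ⟨j, bot, rfl, -⟩; rfl
  · rintro k - _ ⟨j, bot, rfl, -⟩; rfl
  · rintro k hk _ ⟨j, bot, rfl, h⟩
    refine Runs.seq (Runs.line (Q := fun σ => σ = toState { μ with
      i := k, j := j, bot := update bot k (μ.cap (μ.first k)) })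
      (by simp [Prog.IsLine]) (by simp [Prog.lineCost, NatExpr.cost, RealExpr.cost]) ?_) ?_
    · simp [Prog.effect, NatExpr.eval, RealExpr.eval]
    rintro _ rfl
    refine Runs.forLoop (N := μ.numRep) (fun l σ => ∃ b,
      σ = toState { μ with i := k, j := l, bot := update bot k b } ∧
      IsBottleneck μ.cap μ.rep l (μ.first k) (μ.last k) b) ?_ ?_ ?_ ?_ ?_
    · refine ⟨μ.cap (μ.first k), by rw [write_j], ⟨_, le_rfl, hfl k hk, rfl⟩, ?_⟩
      exact fun l hl => absurd hl (Nat.not_lt_zero l)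
    · rintro l - _ ⟨b, rfl, -⟩; rfl
    · rintro l - _ ⟨b, rfl, -⟩; rfl
    · rintro l hl _ ⟨b, rfl, hb1, hb2⟩
      refine Runs.line (by simp [Prog.IsLine])
        (by simp [Prog.lineCost, NatExpr.cost, RealExpr.cost, Test.cost]) ?_
      by_cases hc : μ.first k ≤ μ.rep l ∧ μ.rep l ≤ μ.last k ∧ μ.cap (μ.rep l) ≤ b
      · refine ⟨μ.cap (μ.rep l), ?_, ⟨_, hc.1, hc.2.1, rfl⟩, fun k' hk' h1 h2 => ?_⟩
        · simp [Prog.effect, NatExpr.eval, RealExpr.eval, Test.eval, hc]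
        · rcases Nat.lt_succ_iff_lt_or_eq.mp hk' with hk' | rfl
          · exact hc.2.2.trans (hb2 k' hk' h1 h2)
          · exact le_rfl
      · refine ⟨b, ?_, hb1, fun k' hk' h1 h2 => ?_⟩
        · simp [Prog.effect, NatExpr.eval, RealExpr.eval, Test.eval, hc]
        · rcases Nat.lt_succ_iff_lt_or_eq.mp hk' with hk' | rfl
          · exact hb2 k' hk' h1 h2
          · by_contra hlt
            exact hc ⟨h1, h2, (not_le.mp hlt).le⟩
    · rintro _ ⟨b, rfl, hb⟩
      refine ⟨μ.numRep, update bot k b, by simp, fun i hi => ?_⟩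
      rcases Nat.lt_succ_iff_lt_or_eq.mp hi with hi | rfl
      · rw [update_of_ne hi.ne]; exact h i hi
      · rwa [update_self]
  · rintro _ ⟨j, bot, rfl, h⟩
    exact ⟨_, _, _, rfl, h⟩

end Mem

/-! ### Sorting -/

/-- The order by the key, ties being resolved by the index. -/
def Precedes (key : ℕ → ℝ) (j i : ℕ) : Prop := key j ≤ key i ∧ ¬ (key i ≤ key j ∧ i ≤ j)

open Classical in
/-- The number of indices below `l` that precede `i`. -/
def rankOf (key : ℕ → ℝ) (l i : ℕ) : ℕ := ({j ∈ range l | Precedes key j i} : Finset ℕ).card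

section Rank

variable {key : ℕ → ℝ} {n : ℕ}

theorem Precedes.trans {i j k : ℕ} (h : Precedes key i j) (h' : Precedes key j k) :
    Precedes key i k := by
  refine ⟨h.1.trans h'.1, fun hk => ?_⟩
  have h1 : key j ≤ key i := h'.1.trans hk.1
  have h2 : key k ≤ key j := hk.1.trans h.1
  have h3 : ¬ j ≤ i := fun hh => h.2 ⟨h1, hh⟩
  have h4 : ¬ k ≤ j := fun hh => h'.2 ⟨h2, hh⟩
  omega

theorem not_precedes_self (i : ℕ) : ¬ Precedes key i i := fun h => h.2 ⟨le_rfl, le_rfl⟩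

theorem precedes_or {i j : ℕ} (h : i ≠ j) : Precedes key i j ∨ Precedes key j i := by
  unfold Precedes
  rcases lt_trichotomy (key i) (key j) with h1 | h1 | h1
  · exact Or.inl ⟨h1.le, fun hh => absurd hh.1 (not_le.mpr h1)⟩
  · rcases lt_or_gt_of_ne h with h2 | h2
    · exact Or.inl ⟨h1.le, fun hh => by omega⟩
    · exact Or.inr ⟨h1.ge, fun hh => by omega⟩
  · exact Or.inr ⟨h1.le, fun hh => absurd hh.1 (not_le.mpr h1)⟩

theorem rankOf_lt_rankOf {i j : ℕ} (hi : i < n) (h : Precedes key i j) :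
    rankOf key n i < rankOf key n j := by
  classical
  refine Finset.card_lt_card ⟨fun x hx => ?_, fun hsub => ?_⟩
  · simp only [mem_filter] at hx ⊢
    exact ⟨hx.1, hx.2.trans h⟩
  · have : i ∈ ({j ∈ range n | Precedes key j i} : Finset ℕ) :=
      hsub (mem_filter.mpr ⟨mem_range.mpr hi, h⟩)
    exact not_precedes_self i (mem_filter.mp this).2

theorem rankOf_lt {i : ℕ} (hi : i < n) : rankOf key n i < n := by
  classical
  have h : ({j ∈ range n | Precedes key j i} : Finset ℕ) ⊂ range n := by
    refine ⟨filter_subset _ _, fun hsub => ?_⟩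
    exact not_precedes_self i (mem_filter.mp (hsub (mem_range.mpr hi))).2
  simpa [rankOf] using Finset.card_lt_card h

theorem rankOf_inj {i j : ℕ} (hi : i < n) (hj : j < n) (h : rankOf key n i = rankOf key n j) :
    i = j := by
  by_contra hne
  rcases precedes_or (key := key) hne with h' | h'
  · exact (rankOf_lt_rankOf hi h').ne h
  · exact (rankOf_lt_rankOf hj h').ne h.symm

theorem key_le_of_rankOf_lt {i j : ℕ} (hj : j < n)
    (h : rankOf key n i < rankOf key n j) : key i ≤ key j := by
  have hne : i ≠ j := by rintro rfl; exact lt_irrefl _ h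
  rcases precedes_or (key := key) hne with h' | h'
  · exact h'.1
  · exact absurd (rankOf_lt_rankOf hj h') h.asymm

theorem exists_rankOf_eq {k : ℕ} (hk : k < n) : ∃ i < n, rankOf key n i = k := by
  have himg : (range n).image (rankOf key n) = range n := by
    refine Finset.eq_of_subset_of_card_le ?_ ?_
    · intro x hx
      obtain ⟨i, hi, rfl⟩ := mem_image.mp hx
      exact mem_range.mpr (rankOf_lt (mem_range.mp hi))
    · rw [Finset.card_image_of_injOn]
      intro i hi j hj h
      exact rankOf_inj (mem_range.mp hi) (mem_range.mp hj) h
  obtain ⟨i, hi, h⟩ := mem_image.mp (himg ▸ mem_range.mpr hk)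
  exact ⟨i, mem_range.mp hi, h⟩

theorem rankOf_succ (l i : ℕ) [Decidable (Precedes key l i)] :
    rankOf key (l + 1) i = if Precedes key l i then rankOf key l i + 1 else rankOf key l i := by
  classical
  unfold rankOf
  rw [range_add_one, filter_insert]
  split_ifs
  · rw [card_insert_of_notMem (by simp)]
  · rfl

end Rank

namespace Mem

variable (μ : Mem)

/-- Sorting by counting: each demand is written to the cell given by the number of its predecessors.
The tests must evaluate correctly for all values of the variables that the loops overwrite. -/
theorem runs_sortBy {ji ij : Test} {key : ℕ → ℝ} (hcost : ji.cost + ij.cost ≤ 20)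
    (hji : ∀ i j ord pos, ji.eval (toState { μ with i := i, j := j, ord := ord, pos := pos }) ↔
      key j ≤ key i)
    (hij : ∀ i j ord pos, ij.eval (toState { μ with i := i, j := j, ord := ord, pos := pos }) ↔
      key i ≤ key j) :
    Runs (Prog.sortBy ji ij) μ.toState
      (μ.size 0 * ((3 + ((μ.size 0 * (40 + 12) + 10) + 5)) + 12) + 10)
      fun σ => ∃ i j ord pos, σ = toState { μ with i := i, j := j, ord := ord, pos := pos } ∧
        ∀ i < μ.size 0, ord (rankOf key (μ.size 0) i) = i := by
  classical
  refine Runs.forLoop (N := μ.size 0) (fun k σ => ∃ j ord pos,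
      σ = toState { μ with i := k, j := j, ord := ord, pos := pos } ∧
      ∀ i < k, ord (rankOf key (μ.size 0) i) = i) ?_ ?_ ?_ ?_ ?_
  · exact ⟨μ.j, μ.ord, μ.pos, by rw [write_i], fun i hi => absurd hi (Nat.not_lt_zero i)⟩
  · rintro k - _ ⟨j, ord, pos, rfl, -⟩; rfl
  · rintro k - _ ⟨j, ord, pos, rfl, -⟩; rfl
  · rintro k hk _ ⟨j, ord, pos, rfl, h⟩
    refine Runs.seq (Runs.line (Q := fun σ => σ = toState { μ with
      i := k, j := j, ord := ord, pos := 0 }) (by simp [Prog.IsLine]) le_rfl ?_) ?_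
    · simp [Prog.effect, NatExpr.eval]
    rintro _ rfl
    refine Runs.seq (Q := _) (R := fun σ => σ = toState { μ with
      i := k, j := μ.size 0, ord := ord, pos := rankOf key (μ.size 0) k }) ?_ ?_
    · refine Runs.forLoop (N := μ.size 0) (fun l σ => σ = toState { μ with
        i := k, j := l, ord := ord, pos := rankOf key l k }) ?_ ?_ ?_ ?_ ?_
      · rw [write_j]; simp [rankOf]
      · rintro l - _ rfl; rfl
      · rintro l - _ rfl; rfl
      · rintro l hl _ rfl
        refine Runs.line (by simp [Prog.IsLine]) ?_ ?_
        · simp only [Prog.lineCost, NatExpr.cost, Test.cost]; omega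
        · by_cases hc : Precedes key l k
          · rw [rankOf_succ, if_pos hc]
            have hc' := hc
            unfold Precedes at hc'
            simp only [Prog.effect, Test.eval, hji, hij, NatExpr.eval, nat_i, nat_j]
            rw [if_pos hc']
            simp
          · rw [rankOf_succ, if_neg hc]
            have hc' := hc
            unfold Precedes at hc'
            simp only [Prog.effect, Test.eval, hji, hij, NatExpr.eval, nat_i, nat_j]
            rw [if_neg hc']
            simp
      · rintro _ rfl; rfl
    · rintro _ rfl
      refine Runs.line (by simp [Prog.IsLine]) (by simp [Prog.lineCost, NatExpr.cost]) ?_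
      refine ⟨_, _, _, by simp [Prog.effect, NatExpr.eval]; rfl, fun i hi => ?_⟩
      rcases Nat.lt_succ_iff_lt_or_eq.mp hi with hi | rfl
      -- Earlier entries survive because distinct demands have distinct ranks.
      · rw [update_of_ne, h i hi]
        exact fun he => hi.ne (rankOf_inj (hi.trans hk) hk he)
      · rw [update_self]
  · rintro _ ⟨j, ord, pos, rfl, h⟩
    exact ⟨_, _, _, _, rfl, h⟩

end Mem

/-! ### Layers -/

/-- The demands of rank less than `k` are grouped into layers, the last one having anchor `acc`. -/
structure Anchored (n : ℕ) (rank : ℕ → ℕ) (bot : ℕ → ℝ) (top : ℝ) (anchor : ℕ → ℝ) (k : ℕ)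
    (acc : ℝ) : Prop where
  top_le_acc : top ≤ acc
  top_sep_acc : acc = top ∨ 4 * top ≤ acc
  acc_le : ∀ i < n, k ≤ rank i → acc ≤ bot i
  top_le : ∀ i < n, rank i < k → top ≤ anchor i
  top_sep : ∀ i < n, rank i < k → anchor i = top ∨ 4 * top ≤ anchor i
  anchor_le : ∀ i < n, rank i < k → anchor i ≤ bot i
  bot_le : ∀ i < n, rank i < k → bot i ≤ 4 * anchor i
  le_acc : ∀ i < n, rank i < k → anchor i ≤ acc
  sep_acc : ∀ i < n, rank i < k → anchor i < acc → 4 * anchor i ≤ acc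
  sep : ∀ i < n, rank i < k → ∀ j < n, rank j < k → anchor i < anchor j → 4 * anchor i ≤ anchor j

section Anchored

variable {n : ℕ} {rank : ℕ → ℕ} {bot anchor : ℕ → ℝ} {top acc : ℝ} {k : ℕ}

theorem Anchored.zero (h : ∀ i < n, top ≤ bot i) : Anchored n rank bot top anchor 0 top where
  top_le_acc := le_rfl
  top_sep_acc := Or.inl rfl
  acc_le i hi _ := h i hi
  top_le _ _ h := absurd h (Nat.not_lt_zero _)
  top_sep _ _ h := absurd h (Nat.not_lt_zero _)
  anchor_le _ _ h := absurd h (Nat.not_lt_zero _)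
  bot_le _ _ h := absurd h (Nat.not_lt_zero _)
  le_acc _ _ h := absurd h (Nat.not_lt_zero _)
  sep_acc _ _ h := absurd h (Nat.not_lt_zero _)
  sep _ _ h := absurd h (Nat.not_lt_zero _)

/-- Open a new layer. -/
theorem Anchored.raise (h : Anchored n rank bot top anchor k acc) (htop : 0 ≤ top) {b : ℝ}
    (hb : 4 * acc ≤ b) (hle : ∀ i < n, k ≤ rank i → b ≤ bot i) :
    Anchored n rank bot top anchor k b where
  top_le_acc := by linarith [h.top_le_acc]
  top_sep_acc := Or.inr (by linarith [h.top_le_acc])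
  acc_le := hle
  top_le := h.top_le
  top_sep := h.top_sep
  anchor_le := h.anchor_le
  bot_le := h.bot_le
  le_acc i hi hk := by linarith [h.le_acc i hi hk, h.top_le_acc]
  sep_acc i hi hk _ := by linarith [h.le_acc i hi hk]
  sep := h.sep

/-- Put the next demand into the current layer. -/
theorem Anchored.succ (h : Anchored n rank bot top anchor k acc)
    (hinj : ∀ i < n, ∀ j < n, rank i = rank j → i = j) {i₀ : ℕ} (hi₀ : i₀ < n)
    (hrank : rank i₀ = k) (hbot : bot i₀ ≤ 4 * acc) :
    Anchored n rank bot top (update anchor i₀ acc) (k + 1) acc := by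
  have key : ∀ i < n, rank i < k + 1 → (rank i < k ∧ update anchor i₀ acc i = anchor i) ∨
      (i = i₀ ∧ update anchor i₀ acc i = acc) := by
    intro i hi hlt
    by_cases he : i = i₀
    · subst he; exact Or.inr ⟨rfl, update_self _ _ _⟩
    · refine Or.inl ⟨lt_of_le_of_ne (Nat.lt_succ_iff.mp hlt) fun hh => ?_, update_of_ne he _ _⟩
      exact he (hinj i hi i₀ hi₀ (hh.trans hrank.symm))
  refine ⟨h.top_le_acc, h.top_sep_acc, fun i hi hk => h.acc_le i hi (by omega), ?_, ?_, ?_, ?_,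
    ?_, ?_, ?_⟩
  · intro i hi hk
    rcases key i hi hk with ⟨hk, he⟩ | ⟨rfl, he⟩ <;> rw [he]
    exacts [h.top_le i hi hk, h.top_le_acc]
  · intro i hi hk
    rcases key i hi hk with ⟨hk, he⟩ | ⟨rfl, he⟩ <;> rw [he]
    exacts [h.top_sep i hi hk, h.top_sep_acc]
  · intro i hi hk
    rcases key i hi hk with ⟨hk, he⟩ | ⟨rfl, he⟩ <;> rw [he]
    exacts [h.anchor_le i hi hk, h.acc_le i hi hrank.ge]
  · intro i hi hk
    rcases key i hi hk with ⟨hk, he⟩ | ⟨rfl, he⟩ <;> rw [he]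
    exacts [h.bot_le i hi hk, hbot]
  · intro i hi hk
    rcases key i hi hk with ⟨hk, he⟩ | ⟨rfl, he⟩ <;> rw [he]
    exact h.le_acc i hi hk
  · intro i hi hk
    rcases key i hi hk with ⟨hk, he⟩ | ⟨rfl, he⟩ <;> rw [he]
    · exact h.sep_acc i hi hk
    · exact fun hh => absurd hh (lt_irrefl _)
  · intro i hi hk j hj hk'
    rcases key i hi hk with ⟨hk, he⟩ | ⟨rfl, he⟩ <;>
      rcases key j hj hk' with ⟨hk', he'⟩ | ⟨hj', he'⟩ <;> rw [he, he']
    · exact h.sep i hi hk j hj hk'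
    · exact h.sep_acc i hi hk
    · exact fun hh => absurd hh (not_lt.mpr (h.le_acc j hj hk'))
    · exact fun hh => absurd hh (lt_irrefl _)

end Anchored

/-- The value `c` is the largest representative in `[first, last]` of capacity at most `b`, if
there is one, and `0` otherwise. -/
def IsCrit (cap : ℕ → ℝ) (rep : ℕ → ℕ) (first last : ℕ) (b : ℝ) (M c : ℕ) : Prop :=
  (∀ k < M, first ≤ rep k → rep k ≤ last → cap (rep k) ≤ b → rep k ≤ c) ∧
  (c = 0 ∨ ∃ k < M, c = rep k ∧ first ≤ rep k ∧ rep k ≤ last ∧ cap (rep k) ≤ b)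

/-- The default `0` is harmless: if there is a candidate, it is at most `c = 0`, so it is slot `0`
itself. -/
theorem IsCrit.exists_eq {cap : ℕ → ℝ} {rep : ℕ → ℕ} {first last : ℕ} {b : ℝ} {M c : ℕ}
    (h : IsCrit cap rep first last b M c)
    (hex : ∃ k < M, first ≤ rep k ∧ rep k ≤ last ∧ cap (rep k) ≤ b) :
    ∃ k < M, c = rep k ∧ first ≤ rep k ∧ rep k ≤ last ∧ cap (rep k) ≤ b := by
  rcases h.2 with h0 | h0
  · obtain ⟨k, hk, h1, h2, h3⟩ := hex
    have := h.1 k hk h1 h2 h3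
    exact ⟨k, hk, by omega, h1, h2, h3⟩
  · exact h0

namespace Mem

variable (μ : Mem)

/-- Since the demands come in the order of their bottlenecks, the bottleneck that opens a new layer
is a lower bound for all that remain. -/
theorem runs_anchors {rank : ℕ → ℕ} (htop : 0 ≤ μ.top) (hbot : ∀ i < μ.size 0, μ.top ≤ μ.bot i)
    (hord : ∀ k < μ.size 0, ∃ i < μ.size 0, rank i = k ∧ μ.ord k = i)
    (hinj : ∀ i < μ.size 0, ∀ j < μ.size 0, rank i = rank j → i = j)
    (hmono : ∀ i < μ.size 0, ∀ j < μ.size 0, rank i ≤ rank j → μ.bot i ≤ μ.bot j) :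
    Runs Prog.anchors μ.toState (4 + (μ.size 0 * (30 + 12) + 10))
      fun σ => ∃ k acc anchor, σ = toState { μ with k := k, acc := acc, anchor := anchor } ∧
        Anchored (μ.size 0) rank μ.bot μ.top anchor (μ.size 0) acc := by
  refine Runs.seq (Runs.line (Q := fun σ => σ = toState { μ with acc := μ.top })
    (by simp [Prog.IsLine]) (by simp [Prog.lineCost, NatExpr.cost, RealExpr.cost]) ?_) ?_
  · simp [Prog.effect, NatExpr.eval, RealExpr.eval]
  rintro _ rfl
  refine Runs.forLoop (N := μ.size 0) (fun k σ => ∃ acc anchor,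
      σ = toState { μ with k := k, acc := acc, anchor := anchor } ∧
      Anchored (μ.size 0) rank μ.bot μ.top anchor k acc) ?_ ?_ ?_ ?_ ?_
  · exact ⟨_, μ.anchor, by rw [write_k], Anchored.zero hbot⟩
  · rintro k - _ ⟨acc, anchor, rfl, -⟩; rfl
  · rintro k - _ ⟨acc, anchor, rfl, -⟩; rfl
  · rintro k hk _ ⟨acc, anchor, rfl, h⟩
    refine Runs.line (by simp [Prog.IsLine])
      (by simp [Prog.lineCost, NatExpr.cost, RealExpr.cost, Test.cost]) ?_
    obtain ⟨i, hi, hik, ho⟩ := hord k hk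
    by_cases hc : μ.bot i ≤ 4 * acc
    · refine ⟨_, _, ?_, h.succ hinj hi hik hc⟩
      simp [Prog.effect, NatExpr.eval, RealExpr.eval, Test.eval, ho, hc]
    · have hr := h.raise htop (not_le.mp hc).le
        (fun j hj hkj => hmono i hi j hj (hik.trans_le hkj))
      -- The demand that opens a layer belongs to it: its bottleneck is the new anchor, and `b ≤ 4b`
      -- for `b ≥ 0`.
      have h0 : 0 ≤ μ.bot i := htop.trans (hbot i hi)
      refine ⟨_, _, ?_, hr.succ hinj hi hik (by linarith)⟩
      simp [Prog.effect, NatExpr.eval, RealExpr.eval, Test.eval, ho, hc]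
  · rintro _ ⟨acc, anchor, rfl, h⟩
    exact ⟨_, _, _, rfl, h⟩

theorem runs_crits (hcrit : μ.crit = 0) :
    Runs Prog.crits μ.toState (μ.size 0 * ((μ.numRep * (43 + 12) + 10) + 12) + 10)
      fun σ => ∃ i j crit, σ = toState { μ with i := i, j := j, crit := crit } ∧
      ∀ i < μ.size 0, IsCrit μ.cap μ.rep (μ.first i) (μ.last i) (4 * μ.anchor i) μ.numRep (crit i) := by
  refine Runs.forLoop (N := μ.size 0) (fun k σ => ∃ j crit,
      σ = toState { μ with i := k, j := j, crit := crit } ∧ (∀ i, k ≤ i → crit i = 0) ∧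
      ∀ i < k, IsCrit μ.cap μ.rep (μ.first i) (μ.last i) (4 * μ.anchor i) μ.numRep (crit i))
      ?_ ?_ ?_ ?_ ?_
  · exact ⟨μ.j, μ.crit, by rw [write_i], fun i _ => by rw [hcrit]; rfl,
      fun i hi => absurd hi (Nat.not_lt_zero i)⟩
  · rintro k - _ ⟨j, crit, rfl, -⟩; rfl
  · rintro k - _ ⟨j, crit, rfl, -⟩; rfl
  · rintro k hk _ ⟨j, crit, rfl, h0, h⟩
    refine Runs.forLoop (N := μ.numRep) (fun l σ => ∃ c,
      σ = toState { μ with i := k, j := l, crit := update crit k c } ∧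
      IsCrit μ.cap μ.rep (μ.first k) (μ.last k) (4 * μ.anchor k) l c) ?_ ?_ ?_ ?_ ?_
    · refine ⟨0, ?_, fun l hl => absurd hl (Nat.not_lt_zero l),
        Or.inl rfl⟩
      have : update crit k 0 = crit := by
        rw [← h0 k le_rfl, update_eq_self]
      rw [write_j, this]
    · rintro l - _ ⟨b, rfl, -⟩; rfl
    · rintro l - _ ⟨b, rfl, -⟩; rfl
    · rintro l hl _ ⟨c, rfl, h1, h2⟩
      refine Runs.line (by simp [Prog.IsLine])
        (by simp [Prog.lineCost, NatExpr.cost, RealExpr.cost, Test.cost]) ?_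
      by_cases hc : μ.first k ≤ μ.rep l ∧ μ.rep l ≤ μ.last k ∧
          μ.cap (μ.rep l) ≤ 4 * μ.anchor k ∧ c ≤ μ.rep l
      · refine ⟨μ.rep l, ?_, fun k' hk' e1 e2 e3 => ?_,
          Or.inr ⟨l, Nat.lt_succ_self l, rfl, hc.1, hc.2.1, hc.2.2.1⟩⟩
        · simp [Prog.effect, NatExpr.eval, RealExpr.eval, Test.eval, hc]
        · rcases Nat.lt_succ_iff_lt_or_eq.mp hk' with hk' | rfl
          · exact (h1 k' hk' e1 e2 e3).trans hc.2.2.2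
          · exact le_rfl
      · refine ⟨c, ?_, fun k' hk' e1 e2 e3 => ?_,
          h2.imp_right fun ⟨k', hk', e⟩ => ⟨k', hk'.trans (Nat.lt_succ_self l), e⟩⟩
        · simp [Prog.effect, NatExpr.eval, RealExpr.eval, Test.eval, hc]
        · rcases Nat.lt_succ_iff_lt_or_eq.mp hk' with hk' | rfl
          · exact h1 k' hk' e1 e2 e3
          · by_contra hlt
            exact hc ⟨e1, e2, e3, (not_le.mp hlt).le⟩
    · rintro _ ⟨c, rfl, hc⟩
      refine ⟨μ.numRep, update crit k c, by simp, fun i hi => ?_, fun i hi => ?_⟩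
      · rw [update_of_ne (by omega)]; exact h0 i (by omega)
      · rcases Nat.lt_succ_iff_lt_or_eq.mp hi with hi | rfl
        · rw [update_of_ne hi.ne]; exact h i hi
        · rwa [update_self]
  · rintro _ ⟨j, crit, rfl, -, h⟩
    exact ⟨_, _, _, rfl, h⟩

end Mem

/-! ### The local ratio method -/

namespace Mem

variable (μ : Mem)

theorem eval_sameUser (e f : NatExpr) : (Prog.sameUser e f).eval μ.toState ↔
    μ.user (e.eval μ.toState) = μ.user (f.eval μ.toState) := by
  simp only [Prog.sameUser, Test.eval, NatExpr.eval, nat_user]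
  exact le_antisymm_iff.symm

theorem eval_meets (e f : NatExpr) : (Prog.meets e f).eval μ.toState ↔
    μ.anchor (e.eval μ.toState) = μ.anchor (f.eval μ.toState) ∧
      μ.first (f.eval μ.toState) ≤ μ.crit (e.eval μ.toState) ∧
      μ.crit (e.eval μ.toState) ≤ μ.last (f.eval μ.toState) := by
  simp only [Prog.meets, Test.eval, NatExpr.eval, RealExpr.eval, nat_first, nat_last, nat_crit,
    real_anchor]
  rw [← le_antisymm_iff]

theorem runs_start {active : Test} {act : ℕ → Prop} (hcost : active.cost ≤ 30)
    (hact : ∀ i out gain weight val, active.eval (toState { μ with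
      i := i, out := out, gain := gain, weight := weight, val := val }) ↔ act i) :
    Runs (Prog.start active) μ.toState (3 + (μ.size 0 * (55 + 12) + 10)) fun σ =>
      ∃ i out gain weight,
      σ = toState { μ with i := i, out := out, gain := gain, weight := weight, val := 0 } ∧
      ∀ i < μ.size 0, out i = 0 ∧ gain i = 0 ∧ (act i → weight i = μ.util i) ∧
        (¬ act i → weight i = 0) := by
  refine Runs.seq (Runs.line (Q := fun σ => σ = toState { μ with val := 0 })
    (by simp [Prog.IsLine]) (by simp [Prog.lineCost, NatExpr.cost, RealExpr.cost]) ?_) ?_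
  · simp [Prog.effect, NatExpr.eval, RealExpr.eval]
  rintro _ rfl
  refine Runs.forLoop (N := μ.size 0) (fun k σ => ∃ out gain weight,
      σ = toState { μ with i := k, out := out, gain := gain, weight := weight, val := 0 } ∧
      ∀ i < k, out i = 0 ∧ gain i = 0 ∧ (act i → weight i = μ.util i) ∧
        (¬ act i → weight i = 0)) ?_ ?_ ?_ ?_ ?_
  · exact ⟨μ.out, μ.gain, μ.weight, by rw [write_i], fun i hi => absurd hi (Nat.not_lt_zero i)⟩
  · rintro k - _ ⟨out, gain, weight, rfl, -⟩; rfl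
  · rintro k - _ ⟨out, gain, weight, rfl, -⟩; rfl
  · rintro k hk _ ⟨out, gain, weight, rfl, h⟩
    refine Runs.line (by simp [Prog.IsLine]) ?_ ?_
    · simp only [Prog.lineCost, NatExpr.cost, RealExpr.cost]; omega
    have step : ∀ v : ℝ, (act k → v = μ.util k) → (¬ act k → v = 0) → ∀ i < k + 1,
        update out k 0 i = 0 ∧ update gain k 0 i = 0 ∧
        (act i → update weight k v i = μ.util i) ∧ (¬ act i → update weight k v i = 0) := by
      intro v hv1 hv2 i hi
      rcases Nat.lt_succ_iff_lt_or_eq.mp hi with hi | rfl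
      · simpa only [update_of_ne hi.ne] using h i hi
      · simpa only [update_self] using ⟨trivial, trivial, hv1, hv2⟩
    by_cases hc : act k
    · refine ⟨_, _, _, ?_, step (μ.util k) (fun _ => rfl) (fun hh => absurd hc hh)⟩
      simp [Prog.effect, NatExpr.eval, RealExpr.eval, hact, hc]
    · refine ⟨_, _, _, ?_, step 0 (fun hh => absurd hh hc) (fun _ => rfl)⟩
      simp [Prog.effect, NatExpr.eval, RealExpr.eval, hact, hc]
  · rintro _ ⟨out, gain, weight, rfl, h⟩
    exact ⟨_, _, _, _, rfl, h⟩

theorem runs_raise {rank : ℕ → ℕ} (κ : ℚ) (hgain : ∀ i < μ.size 0, μ.gain i = 0)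
    (hord : ∀ k < μ.size 0, ∃ i < μ.size 0, rank i = k ∧ μ.ord k = i)
    (hinj : ∀ i < μ.size 0, ∀ j < μ.size 0, rank i = rank j → i = j)
    (hlt : ∀ i < μ.size 0, rank i < μ.size 0) :
    Runs (Prog.raise κ) μ.toState
      (μ.size 0 * (5 + (5 + ((μ.size 0 * (80 + 12) + 10) + 15)) + 12) + 10)
      fun σ => ∃ i j k acc gain,
      σ = toState { μ with i := i, j := j, k := k, acc := acc, gain := gain } ∧
      IsGain (μ.size 0) rank (conflict μ.user μ.first μ.last μ.crit μ.norm μ.anchor κ)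
        μ.weight gain := by
  set w := conflict μ.user μ.first μ.last μ.crit μ.norm μ.anchor κ with hw
  refine Runs.forLoop (N := μ.size 0) (fun k σ => ∃ i j acc gain,
      σ = toState { μ with i := i, j := j, k := k, acc := acc, gain := gain } ∧
      (∀ i < μ.size 0, k ≤ rank i → gain i = 0) ∧
      ∀ i < μ.size 0, rank i < k → gain i = max 0
        (μ.weight i - ∑ j ∈ range (μ.size 0) with rank j < rank i, gain j * w j i)) ?_ ?_ ?_ ?_ ?_
  · exact ⟨μ.i, μ.j, μ.acc, μ.gain, by rw [write_k], fun i hi _ => hgain i hi,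
      fun i _ hi => absurd hi (Nat.not_lt_zero _)⟩
  · rintro k - _ ⟨i, j, acc, gain, rfl, -⟩; rfl
  · rintro k - _ ⟨i, j, acc, gain, rfl, -⟩; rfl
  · rintro k hk _ ⟨i', j, acc, gain, rfl, h0, h⟩
    obtain ⟨i, hi, hik, ho⟩ := hord k hk
    refine Runs.seq (Runs.line (Q := fun σ => σ = toState { μ with
      i := i, j := j, k := k, acc := acc, gain := gain })
      (by simp [Prog.IsLine]) (by simp [Prog.lineCost, NatExpr.cost]) ?_) ?_
    · simp [Prog.effect, NatExpr.eval, ho]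
    rintro _ rfl
    refine Runs.seq (Runs.line (Q := fun σ => σ = toState { μ with
      i := i, j := j, k := k, acc := μ.weight i, gain := gain })
      (by simp [Prog.IsLine]) (by simp [Prog.lineCost, NatExpr.cost, RealExpr.cost]) ?_) ?_
    · simp [Prog.effect, NatExpr.eval, RealExpr.eval]
    rintro _ rfl
    refine Runs.seq (R := fun σ => σ = toState { μ with
      i := i, j := μ.size 0, k := k, gain := gain,
      acc := μ.weight i - ∑ j ∈ range (μ.size 0), gain j * w j i }) ?_ ?_
    · refine Runs.forLoop (N := μ.size 0) (fun l σ => ∃ acc, σ = toState { μ with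
        i := i, j := l, k := k, acc := acc, gain := gain } ∧
        acc = μ.weight i - ∑ j ∈ range l, gain j * w j i) ?_ ?_ ?_ ?_ ?_
      · exact ⟨_, by rw [write_j], by simp⟩
      · rintro l - _ ⟨acc, rfl, -⟩; rfl
      · rintro l - _ ⟨acc, rfl, -⟩; rfl
      · rintro l hl _ ⟨acc, rfl, hacc⟩
        refine Runs.line (by simp [Prog.IsLine])
          (by simp [Prog.lineCost, NatExpr.cost, RealExpr.cost, Test.cost, Prog.sameUser,
            Prog.meets]) ?_
        refine ⟨acc - gain l * w l i, ?_, by rw [sum_range_succ, hacc]; ring⟩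
        by_cases h1 : μ.user l = μ.user i <;>
        by_cases h2 : μ.anchor l = μ.anchor i ∧ μ.first i ≤ μ.crit l ∧ μ.crit l ≤ μ.last i
        all_goals
          simp only [Prog.effect, eval_sameUser, eval_meets, NatExpr.eval, RealExpr.eval,
            nat_i, nat_j, h1, if_true, if_false, write_acc, real_acc, real_gain]
          simp only [hw, conflict, h1, h2, and_self, if_true, if_false]
          simp [mul_add, sub_add_eq_sub_sub]
          try rw [h2.1]
      · rintro _ ⟨acc, rfl, rfl⟩; rfl
    rintro _ rfl
    -- The program sums over all demands without comparing ranks. This is correct because the gains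
    -- of rank at least `k` are still `0`; the entry that is about to be written does not occur in
    -- the sum.
    have hsum : ∀ x : ℝ, ∑ j ∈ range (μ.size 0), gain j * w j i =
        ∑ j ∈ range (μ.size 0) with rank j < rank i, update gain i x j * w j i := by
      intro x
      rw [Finset.sum_filter]
      refine Finset.sum_congr rfl fun j hj => ?_
      split_ifs with hlt
      · rw [update_of_ne]
        rintro rfl
        exact lt_irrefl _ hlt
      · rw [h0 j (mem_range.mp hj) (by omega), zero_mul]
    set v := μ.weight i - ∑ j ∈ range (μ.size 0), gain j * w j i with hv
    refine Runs.line (by simp [Prog.IsLine])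
      (by simp [Prog.lineCost, NatExpr.cost, RealExpr.cost, Test.cost]) ?_
    refine ⟨i, μ.size 0, v, update gain i (max 0 v), ?_, fun i' hi' hk' => ?_, fun i' hi' hk' => ?_⟩
    · by_cases hle : 0 ≤ v
      · simp [Prog.effect, NatExpr.eval, RealExpr.eval, Test.eval, hle]
      -- If the remaining weight is negative, the entry keeps its initial value `0`, which is the
      -- maximum.
      · have : update gain i (max 0 v) = gain := by
          rw [max_eq_left (not_le.mp hle).le, ← h0 i hi hik.ge, update_eq_self]
        rw [this]
        simp [Prog.effect, NatExpr.eval, RealExpr.eval, Test.eval, hle]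
    · rw [update_of_ne (by rintro rfl; omega)]
      exact h0 i' hi' (by omega)
    · rcases Nat.lt_succ_iff_lt_or_eq.mp hk' with hk' | hk'
      · have hne : i' ≠ i := by rintro rfl; omega
        rw [update_of_ne hne, h i' hi' hk']
        congr 2
        refine Finset.sum_congr rfl fun j hj => ?_
        have := (mem_filter.mp hj).2
        rw [update_of_ne (by rintro rfl; omega)]
      · obtain rfl := hinj i' hi' i hi (hk'.trans hik.symm)
        rw [update_self, ← hsum]
  · rintro _ ⟨i, j, acc, gain, rfl, -, h⟩
    exact ⟨_, _, _, _, _, rfl, fun i hi => h i hi (hlt i hi)⟩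

/-- The set of demands below `n` with entry `1`. -/
def chosen (n : ℕ) (out : ℕ → ℕ) : Finset ℕ := {i ∈ range n | out i = 1}

theorem chosen_update {n i : ℕ} {out : ℕ → ℕ} (hi : i < n) :
    chosen n (update out i 1) = insert i (chosen n out) := by
  ext j
  simp only [chosen, mem_filter, mem_range, mem_insert]
  by_cases h : j = i
  · subst h; simp [hi]
  · simp [h]

/-- The ranks are visited downwards, so all demands chosen so far have higher rank than the current
one, and the obstruction can be summed over all chosen demands. -/
theorem runs_select {rank : ℕ → ℕ} (κ : ℚ) (hout : ∀ i < μ.size 0, μ.out i = 0) (hval : μ.val = 0)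
    (hord : ∀ k < μ.size 0, ∃ i < μ.size 0, rank i = k ∧ μ.ord k = i)
    (hinj : ∀ i < μ.size 0, ∀ j < μ.size 0, rank i = rank j → i = j)
    (hlt : ∀ i < μ.size 0, rank i < μ.size 0) :
    Runs (Prog.select κ) μ.toState
      (4 + (μ.size 0 * (5 + (5 + (3 + ((μ.size 0 * (80 + 12) + 10) + 30))) + 12) + 10))
      fun σ => ∃ i j k pos acc out,
      σ = toState { μ with i := i, j := j, k := k, pos := pos, acc := acc, out := out,
                           val := ∑ i ∈ chosen (μ.size 0) out, μ.util i } ∧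
      (∀ i < μ.size 0, out i = 0 ∨ out i = 1) ∧
      IsSelected (μ.size 0) rank (conflict μ.user μ.first μ.last μ.crit μ.norm μ.anchor κ)
        μ.gain (chosen (μ.size 0) out) := by
  set w := conflict μ.user μ.first μ.last μ.crit μ.norm μ.anchor κ with hw
  set n := μ.size 0 with hn
  refine Runs.seq (Runs.line (Q := fun σ => σ = toState { μ with pos := n })
    (by simp [Prog.IsLine]) (by simp [Prog.lineCost, NatExpr.cost]) ?_) ?_
  · simp [Prog.effect, NatExpr.eval, hn]
  rintro _ rfl
  refine Runs.forLoop (N := n) (fun k σ => ∃ i j acc out,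
      σ = toState { μ with i := i, j := j, k := k, pos := n - k, acc := acc, out := out,
                           val := ∑ i ∈ chosen n out, μ.util i } ∧
      (∀ i < n, out i = 0 ∨ out i = 1 ∧ n - k ≤ rank i) ∧
      ∀ i < n, n - k ≤ rank i → (i ∈ chosen n out ↔ 0 < μ.gain i ∧
        ∑ j ∈ chosen n out with rank i < rank j, w i j < 1)) ?_ ?_ ?_ ?_ ?_
  · refine ⟨μ.i, μ.j, μ.acc, μ.out, ?_, fun i hi => Or.inl (hout i hi), fun i hi hr => ?_⟩
    · have : chosen n μ.out = ∅ := by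
        refine Finset.eq_empty_of_forall_notMem fun i hi => ?_
        obtain ⟨h1, h2⟩ := mem_filter.mp hi
        rw [hout i (mem_range.mp h1)] at h2
        exact zero_ne_one h2
      rw [write_k, this, Finset.sum_empty, ← hval]
      rfl
    · have := hlt i hi
      omega
  · rintro k - _ ⟨i, j, acc, out, rfl, -⟩; rfl
  · rintro k - _ ⟨i, j, acc, out, rfl, -⟩; rfl
  · rintro k hk _ ⟨i', j, acc, out, rfl, h0, h⟩
    obtain ⟨i, hi, hik, ho⟩ := hord (n - (k + 1)) (by omega)
    refine Runs.seq (Runs.line (Q := fun σ => σ = toState { μ with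
      i := i', j := j, k := k, pos := n - (k + 1), acc := acc, out := out,
      val := ∑ i ∈ chosen n out, μ.util i })
      (by simp [Prog.IsLine]) (by simp [Prog.lineCost, NatExpr.cost]) ?_) ?_
    · simp [Prog.effect, NatExpr.eval, Nat.sub_sub]
    rintro _ rfl
    refine Runs.seq (Runs.line (Q := fun σ => σ = toState { μ with
      i := i, j := j, k := k, pos := n - (k + 1), acc := acc, out := out,
      val := ∑ i ∈ chosen n out, μ.util i })
      (by simp [Prog.IsLine]) (by simp [Prog.lineCost, NatExpr.cost]) ?_) ?_
    · simp [Prog.effect, NatExpr.eval, ho]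
    rintro _ rfl
    refine Runs.seq (Runs.line (Q := fun σ => σ = toState { μ with
      i := i, j := j, k := k, pos := n - (k + 1), acc := 0, out := out,
      val := ∑ i ∈ chosen n out, μ.util i })
      (by simp [Prog.IsLine]) (by simp [Prog.lineCost, NatExpr.cost, RealExpr.cost]) ?_) ?_
    · simp [Prog.effect, NatExpr.eval, RealExpr.eval]
    rintro _ rfl
    refine Runs.seq (R := fun σ => σ = toState { μ with
      i := i, j := n, k := k, pos := n - (k + 1), out := out,
      acc := ∑ j ∈ chosen n out, w i j, val := ∑ i ∈ chosen n out, μ.util i }) ?_ ?_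
    · refine Runs.forLoop (N := n) (fun l σ => ∃ acc, σ = toState { μ with
        i := i, j := l, k := k, pos := n - (k + 1), acc := acc, out := out,
        val := ∑ i ∈ chosen n out, μ.util i } ∧
        acc = ∑ j ∈ range l, if out j = 1 then w i j else 0) ?_ ?_ ?_ ?_ ?_
      · exact ⟨_, by rw [write_j], by simp⟩
      · rintro l - _ ⟨acc, rfl, -⟩; rfl
      · rintro l - _ ⟨acc, rfl, -⟩; rfl
      · rintro l hl _ ⟨acc, rfl, hacc⟩
        refine Runs.line (by simp [Prog.IsLine])
          (by simp [Prog.lineCost, NatExpr.cost, RealExpr.cost, Test.cost, Prog.sameUser,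
            Prog.meets]) ?_
        refine ⟨acc + (if out l = 1 then w i l else 0), ?_, by rw [sum_range_succ, hacc]⟩
        rcases h0 l hl with h3 | ⟨h3, -⟩
        · simp [Prog.effect, Test.eval, NatExpr.eval, h3]
        by_cases h1 : μ.user i = μ.user l <;>
        by_cases h2 : μ.anchor i = μ.anchor l ∧ μ.first l ≤ μ.crit i ∧ μ.crit i ≤ μ.last l
        all_goals
          simp only [Prog.effect, eval_sameUser, eval_meets, NatExpr.eval, RealExpr.eval,
            Test.eval, nat_out, h3, le_refl,
            nat_i, nat_j, h1, if_true, if_false, write_acc, real_acc]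
          simp only [hw, conflict, h1, h2, and_self, if_true, if_false]
          simp [add_assoc]
          try rw [h2.1]
      · rintro _ ⟨acc, rfl, rfl⟩
        simp only [chosen, Finset.sum_filter]
    rintro _ rfl
    have hnew : ∀ j ∈ chosen n out, n - k ≤ rank j := by
      intro j hj
      obtain ⟨h1, h2⟩ := mem_filter.mp hj
      rcases h0 j (mem_range.mp h1) with h3 | h3
      · rw [h3] at h2; exact absurd h2 zero_ne_one
      · exact h3.2
    have hi_not : i ∉ chosen n out := fun hh => by have := hnew i hh; omega
    have hsum : ∀ C, (C = chosen n out ∨ C = insert i (chosen n out)) →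
        ∑ j ∈ C with rank i < rank j, w i j = ∑ j ∈ chosen n out, w i j := by
      intro C hC
      have : C.filter (fun j => rank i < rank j) = chosen n out := by
        ext j
        rw [mem_filter]
        constructor
        · rintro ⟨hj, hr⟩
          rcases hC with rfl | rfl
          · exact hj
          · rcases mem_insert.mp hj with rfl | hj
            · exact absurd hr (lt_irrefl _)
            · exact hj
        · intro hj
          refine ⟨?_, by have := hnew j hj; omega⟩
          rcases hC with rfl | rfl
          · exact hj
          · exact mem_insert_of_mem hj
      rw [this]
    -- Earlier decisions concern higher ranks and look only at still higher ones, so adding `i` does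
    -- not affect them.
    have hold : ∀ C, (C = chosen n out ∨ C = insert i (chosen n out)) → ∀ i' < n,
        n - k ≤ rank i' → (i' ∈ C ↔ 0 < μ.gain i' ∧ ∑ j ∈ C with rank i' < rank j, w i' j < 1) := by
      rintro C (rfl | rfl) i' hi' hr
      · exact h i' hi' hr
      · rw [filter_insert, if_neg (by omega), mem_insert, h i' hi' hr]
        refine or_iff_right ?_
        rintro rfl
        omega
    refine Runs.line (by simp [Prog.IsLine])
      (by simp [Prog.lineCost, NatExpr.cost, RealExpr.cost, Test.cost]) ?_
    by_cases hacc : ∑ j ∈ chosen n out, w i j < 1 ∧ 0 < μ.gain i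
    · refine ⟨i, n, ∑ j ∈ chosen n out, w i j, update out i 1, ?_, fun i' hi' => ?_,
        fun i' hi' hr => ?_⟩
      · rw [chosen_update hi, sum_insert hi_not]
        have h1 := not_le.mpr hacc.1
        have h2 := not_le.mpr hacc.2
        simp [Prog.effect, NatExpr.eval, RealExpr.eval, Test.eval, hacc, add_comm]
      · by_cases hii : i' = i
        · subst hii; rw [update_self]; exact Or.inr ⟨rfl, hik.ge⟩
        · rw [update_of_ne hii]
          exact (h0 i' hi').imp_right fun hh => ⟨hh.1, by omega⟩
      · rw [chosen_update hi]
        by_cases hrk : n - k ≤ rank i'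
        · exact hold _ (Or.inr rfl) i' hi' hrk
        · obtain rfl := hinj i' hi' i hi (by omega)
          rw [hsum _ (Or.inr rfl)]
          simp [hacc]
    · refine ⟨i, n, ∑ j ∈ chosen n out, w i j, out, ?_, fun i' hi' => ?_, fun i' hi' hr => ?_⟩
      · have hacc' : ¬ (¬ 1 ≤ ∑ j ∈ chosen n out, w i j ∧ ¬ μ.gain i ≤ 0) := fun hh =>
          hacc ⟨not_le.mp hh.1, not_le.mp hh.2⟩
        simp only [Prog.effect, NatExpr.eval, RealExpr.eval, Test.eval, real_acc, real_gain, nat_i,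
          Rat.cast_one, Rat.cast_zero]
        rw [if_neg hacc']
        simp
      · exact (h0 i' hi').imp_right fun hh => ⟨hh.1, by omega⟩
      · by_cases hrk : n - k ≤ rank i'
        · exact hold _ (Or.inl rfl) i' hi' hrk
        · obtain rfl := hinj i' hi' i hi (by omega)
          rw [hsum _ (Or.inl rfl)]
          exact iff_of_false hi_not fun hh => hacc ⟨hh.2, hh.1⟩
  · rintro _ ⟨i, j, acc, out, rfl, h0, h⟩
    refine ⟨_, _, _, _, _, _, rfl, fun i hi => (h0 i hi).imp_right And.left, fun i => ?_⟩
    constructor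
    · intro hi
      have hin := mem_range.mp (mem_filter.mp hi).1
      exact ⟨hin, (h i hin (by omega)).mp hi⟩
    · rintro ⟨hin, hh⟩
      exact (h i hin (by omega)).mpr hh

end Mem

theorem toArray_of_lt {α : Type} [Zero α] {l : ℕ} (f : Fin l → α) {i : ℕ} (h : i < l) :
    toArray f i = f ⟨i, h⟩ := dif_pos h

@[simp] theorem toArray_val {α : Type} [Zero α] {l : ℕ} (f : Fin l → α) (i : Fin l) :
    toArray f i = f i := toArray_of_lt f i.2

/-! ### The preprocessing as a whole. -/

namespace Instance

variable (I : Instance)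

@[simp] theorem mem_size_zero : I.mem.size 0 = I.n := rfl

/-- The memory `ν` holds the layering `Λ` of the demands of the instance. -/
structure Layered (ν : Mem) (Λ : Layering) : Prop where
  size_eq : ν.size 0 = I.n
  util_eq : ν.util = I.mem.util
  n_eq : Λ.n = I.n
  user_eq : Λ.user = I.mem.user
  first_eq : Λ.first = I.mem.first
  last_eq : Λ.last = I.mem.last
  cap_eq : Λ.cap = I.mem.cap
  user_eq' : ν.user = Λ.user
  first_eq' : ν.first = Λ.first
  last_eq' : ν.last = Λ.last
  crit_eq : ν.crit = Λ.crit
  norm_eq : ν.norm = Λ.size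
  anchor_eq : ν.anchor = Λ.anchor
  top_eq : ν.top = Λ.top
  ord_rank : ∀ i < I.n, ν.ord (Λ.rank i) = i
  rank_lt : ∀ i < I.n, Λ.rank i < I.n
  rank_surj : ∀ k < I.n, ∃ i < I.n, Λ.rank i = k
  size_norm : ∀ i : Fin I.n, Λ.size i = ‖I.demand i‖
  slot_lt : ∀ s ∈ Λ.slots, s < I.m
  dom : ∀ t < I.m, ∃ s ∈ Λ.slots, Λ.cap s ≤ Λ.cap t ∧
    ∀ i < I.n, Λ.first i ≤ t → t ≤ Λ.last i → Λ.first i ≤ s ∧ s ≤ Λ.last i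

theorem runs_layers (hI : I.NoBottleneck) :
    Runs Prog.layers I.mem.toState (1000 * (I.n ^ 2 + I.m)) fun σ =>
      ∃ ν Λ, σ = Mem.toState ν ∧ I.Layered ν Λ := by
  have hfl : ∀ i < I.n, I.mem.first i ≤ I.mem.last i := by
    intro i hi
    simp only [mem, toArray_of_lt _ hi]
    exact I.first_le_last _
  have hlm : ∀ i < I.n, I.mem.last i < I.m := by
    intro i hi
    simp only [mem, toArray_of_lt _ hi]
    exact (I.last _).2
  have hnn : I.n ≤ I.n ^ 2 := Nat.le_self_pow two_ne_zero _
  have hm := I.m_pos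
  -- The bound `M ≤ 2n + 1` turns the costs of the loops over representatives into multiples of `n ^
  -- 2` and `n`; additive constants are absorbed by `m ≥ 1`.
  refine Runs.mono (c := (60 * I.n + 13) + ((I.m * 60 + 10) + ((100 * I.n ^ 2 + 80 * I.n + 10) +
    ((52 * I.n ^ 2 + 30 * I.n + 10) + ((42 * I.n + 14) + ((110 * I.n ^ 2 + 77 * I.n + 10) +
    (52 * I.n ^ 2 + 30 * I.n + 10))))))) ?_ (by omega) fun _ h => h
  refine Runs.seq (Mem.runs_measure _ rfl rfl) ?_
  rintro _ ⟨i₁, mark, norm, top, rfl, hmeas⟩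
  refine Runs.seq (Mem.runs_scan _ (n := I.n) hmeas.mark_iff rfl) ?_
  rintro _ ⟨i₂, rep, M, rfl, hscan⟩
  have hM := hscan.numRep_le
  have hM' : I.n * M ≤ I.n * (2 * I.n + 1) := Nat.mul_le_mul_left _ hM
  change Scanned I.n I.mem.first I.mem.last I.mem.cap rep M I.m at hscan
  refine Runs.seq (Runs.mono (Mem.runs_bottlenecks _ hfl)
    (by simp only [mem_size_zero]; nlinarith) fun _ h => h) ?_
  rintro _ ⟨i₃, j₃, bot, rfl, hbot⟩
  change ∀ i < I.n, Mem.IsBottleneck I.mem.cap rep M (I.mem.first i) (I.mem.last i) (bot i) at hbot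
  refine Runs.seq (Runs.mono (Mem.runs_sortBy (key := bot) _
    (by simp [Test.cost, RealExpr.cost, NatExpr.cost]) (fun _ _ _ _ => Iff.rfl)
    (fun _ _ _ _ => Iff.rfl)) (by simp only [mem_size_zero]; nlinarith) fun _ h => h) ?_
  rintro _ ⟨i₄, j₄, ord, pos₄, rfl, hord⟩
  change ∀ i < I.n, ord (rankOf bot I.n i) = i at hord
  have htopcap : ∀ t < I.m, top ≤ I.mem.cap t := by
    intro t ht
    simp only [mem, toArray_of_lt _ ht]
    refine hmeas.top_le _ (I.cap_nonneg _) fun i hi => ?_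
    rw [hmeas.norm_eq i hi]
    have h1 := hI ⟨i, hi⟩ ⟨t, ht⟩
    rw [Complex.norm_def, Complex.normSq_apply] at h1
    simpa only [mem, toArray_of_lt _ (show i < I.n from hi)] using h1
  have htopbot : ∀ i < I.n, top ≤ bot i := by
    intro i hi
    obtain ⟨⟨s, -, hs, he⟩, -⟩ := hbot i hi
    rw [he]
    exact htopcap s (hs.trans_lt (hlm i hi))
  refine Runs.seq (Runs.mono (Mem.runs_anchors (rank := rankOf bot I.n) _ hmeas.top_nonneg htopbot
    (fun k hk => ?_) (fun i hi j hj => rankOf_inj hi hj) (fun i hi j hj hij => ?_))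
    (by simp only [mem_size_zero]; omega) fun _ h => h) ?_
  · obtain ⟨i, hi, rfl⟩ := exists_rankOf_eq (key := bot) (n := I.n) hk
    exact ⟨i, hi, rfl, hord i hi⟩
  · rcases hij.lt_or_eq with h | h
    · exact key_le_of_rankOf_lt (n := I.n) hj h
    · rw [rankOf_inj hi hj h]
  rintro _ ⟨k₅, acc, anchor, rfl, hanc⟩
  change Anchored I.n (rankOf bot I.n) bot top anchor I.n acc at hanc
  refine Runs.seq (Runs.mono (Mem.runs_crits _ rfl)
    (by simp only [mem_size_zero]; nlinarith) fun _ h => h) ?_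
  rintro _ ⟨i₆, j₆, crit, rfl, hcrit⟩
  change ∀ i < I.n, IsCrit I.mem.cap rep (I.mem.first i) (I.mem.last i) (4 * anchor i) M (crit i)
    at hcrit
  refine Runs.mono (Mem.runs_sortBy (key := fun i => (I.mem.last i : ℝ)) _
    (by simp [Test.cost, NatExpr.cost]) (fun _ _ _ _ => Nat.cast_le.symm)
    (fun _ _ _ _ => Nat.cast_le.symm)) (by simp only [mem_size_zero]; nlinarith) ?_
  rintro _ ⟨i₇, j₇, ord', pos₇, rfl, hord'⟩
  have hcrit' : ∀ i < I.n, ∃ k < M, crit i = rep k ∧ I.mem.first i ≤ rep k ∧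
      rep k ≤ I.mem.last i ∧ I.mem.cap (rep k) ≤ 4 * anchor i := by
    intro i hi
    refine (hcrit i hi).exists_eq ?_
    -- A low representative exists: the bottleneck is the capacity of a slot of the interval,
    -- possibly not a representative, and the slot that dominates it is in the interval and has no
    -- larger capacity.
    obtain ⟨⟨s, hs1, hs2, he⟩, -⟩ := hbot i hi
    obtain ⟨k, hk, hc, hact⟩ := hscan.dom s (hs2.trans_lt (hlm i hi))
    obtain ⟨h1, h2⟩ := hact i hi hs1 hs2
    exact ⟨k, hk, h1, h2, (he ▸ hc).trans (hanc.bot_le i hi (rankOf_lt hi))⟩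
  let Λ : Layering :=
    { n := I.n
      user := I.mem.user
      first := I.mem.first
      last := I.mem.last
      crit := crit
      rank := rankOf (fun i => (I.mem.last i : ℝ)) I.n
      size := norm
      anchor := anchor
      top := top
      -- Only representatives are slots of the layering; the others are recovered from domination.
      slots := {s | ∃ k < M, s = rep k}
      cap := I.mem.cap
      size_nonneg := fun i hi => by rw [hmeas.norm_eq i hi]; exact Real.sqrt_nonneg _
      size_le := hmeas.norm_le
      top_nonneg := hmeas.top_nonneg
      top_le_cap := by
        rintro _ ⟨k, hk, rfl⟩
        exact htopcap _ (hscan.rep_lt k hk)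
      top_le := fun i hi => hanc.top_le i hi (rankOf_lt hi)
      top_sep := fun i hi => hanc.top_sep i hi (rankOf_lt hi)
      sep := fun i hi j hj => hanc.sep i hi (rankOf_lt hi) j hj (rankOf_lt hj)
      anchor_le := by
        rintro i hi _ ⟨k, hk, rfl⟩ h1 h2
        exact (hanc.anchor_le i hi (rankOf_lt hi)).trans ((hbot i hi).2 k hk h1 h2)
      crit_mem := fun i hi => by
        obtain ⟨k, hk, he, -⟩ := hcrit' i hi
        exact ⟨k, hk, he⟩
      first_le_crit := fun i hi => by
        obtain ⟨k, hk, he, h1, h2, h3⟩ := hcrit' i hi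
        rw [he]; exact h1
      crit_le_last := fun i hi => by
        obtain ⟨k, hk, he, h1, h2, h3⟩ := hcrit' i hi
        rw [he]; exact h2
      cap_crit := fun i hi => by
        obtain ⟨k, hk, he, h1, h2, h3⟩ := hcrit' i hi
        rw [he]; exact h3
      le_crit := by
        rintro i hi _ ⟨k, hk, rfl⟩ h1 h2 h3
        exact (hcrit i hi).1 k hk h1 h2 h3
      rank_inj := fun i hi j hj => rankOf_inj hi hj
      last_le := fun i _ j hj h => Nat.cast_le.mp
        (key_le_of_rankOf_lt (key := fun i => (I.mem.last i : ℝ)) hj h) }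
  refine ⟨_, Λ, rfl, rfl, rfl, rfl, rfl, rfl, rfl, rfl, rfl, rfl, rfl, rfl, rfl, rfl, rfl, hord',
    fun i hi => rankOf_lt hi, fun k hk => exists_rankOf_eq hk, fun i => ?_, ?_, fun t ht => ?_⟩
  · change norm i = _
    rw [hmeas.norm_eq i i.2, Complex.norm_def, Complex.normSq_apply]
    simp [mem]
  · rintro _ ⟨k, hk, rfl⟩
    exact hscan.rep_lt k hk
  · obtain ⟨k, hk, h⟩ := hscan.dom t ht
    exact ⟨rep k, ⟨k, hk, rfl⟩, h⟩

end Instance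

/-! ### A complete run of the local ratio method, and the choice between two results. -/

namespace Mem

variable (μ : Mem)

theorem runs_localRatio {rank : ℕ → ℕ} {active : Test} {act : ℕ → Prop} (κ : ℚ)
    (hcost : active.cost ≤ 30)
    (hact : ∀ i out gain weight val, active.eval (toState { μ with
      i := i, out := out, gain := gain, weight := weight, val := val }) ↔ act i)
    (hord : ∀ k < μ.size 0, ∃ i < μ.size 0, rank i = k ∧ μ.ord k = i)
    (hinj : ∀ i < μ.size 0, ∀ j < μ.size 0, rank i = rank j → i = j)
    (hlt : ∀ i < μ.size 0, rank i < μ.size 0) :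
    Runs (Prog.localRatio κ active) μ.toState (500 * (μ.size 0 ^ 2 + 1))
      fun σ => ∃ i j k pos acc out gain weight,
      σ = toState { μ with i := i, j := j, k := k, pos := pos, acc := acc, out := out,
                           gain := gain, weight := weight,
                           val := ∑ i ∈ chosen (μ.size 0) out, μ.util i } ∧
      (∀ i < μ.size 0, (act i → weight i = μ.util i) ∧ (¬ act i → weight i = 0)) ∧
      (∀ i < μ.size 0, out i = 0 ∨ out i = 1) ∧
      IsGain (μ.size 0) rank (conflict μ.user μ.first μ.last μ.crit μ.norm μ.anchor κ)
        weight gain ∧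
      IsSelected (μ.size 0) rank (conflict μ.user μ.first μ.last μ.crit μ.norm μ.anchor κ)
        gain (chosen (μ.size 0) out) := by
  have hnn : μ.size 0 ≤ μ.size 0 ^ 2 := Nat.le_self_pow two_ne_zero _
  refine Runs.mono (c := (67 * μ.size 0 + 13) + ((92 * μ.size 0 ^ 2 + 47 * μ.size 0 + 10) +
    (92 * μ.size 0 ^ 2 + 65 * μ.size 0 + 14))) ?_ (by omega) fun _ h => h
  refine Runs.seq (Runs.mono (μ.runs_start hcost hact) (by omega) fun _ h => h) ?_
  rintro _ ⟨i₁, out₁, gain₁, weight, rfl, h₁⟩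
  refine Runs.seq (Runs.mono (Mem.runs_raise _ κ (fun i hi => (h₁ i hi).2.1) hord hinj hlt)
    (by simp only []; nlinarith) fun _ h => h) ?_
  rintro _ ⟨i₂, j₂, k₂, acc₂, gain, rfl, h₂⟩
  refine Runs.mono (Mem.runs_select _ κ (fun i hi => (h₁ i hi).1) rfl hord hinj hlt)
    (by simp only []; nlinarith) ?_
  rintro _ ⟨i₃, j₃, k₃, pos, acc₃, out, rfl, h01, h₃⟩
  exact ⟨_, _, _, _, _, out, gain, weight, rfl, fun i hi => (h₁ i hi).2.2, h01, h₂, h₃⟩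

theorem runs_save : Runs Prog.save μ.toState (μ.size 0 * (10 + 12) + 20) fun σ =>
    ∃ i saved, σ = toState { μ with i := i, saved := saved, savedVal := μ.val } ∧
      ∀ i < μ.size 0, saved i = μ.out i := by
  refine Runs.mono (c := 6 + (μ.size 0 * (10 + 12) + 10)) ?_ (by omega) fun _ h => h
  refine Runs.seq (Runs.line (Q := fun σ => σ = toState { μ with savedVal := μ.val })
    (by simp [Prog.IsLine]) (by simp [Prog.lineCost, NatExpr.cost, RealExpr.cost]) ?_) ?_
  · simp [Prog.effect, NatExpr.eval, RealExpr.eval]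
  rintro _ rfl
  refine Runs.forLoop (N := μ.size 0) (fun k σ => ∃ saved,
      σ = toState { μ with i := k, saved := saved, savedVal := μ.val } ∧
      ∀ i < k, saved i = μ.out i) ?_ ?_ ?_ ?_ ?_
  · exact ⟨μ.saved, by rw [write_i], fun i hi => absurd hi (Nat.not_lt_zero i)⟩
  · rintro k - _ ⟨saved, rfl, -⟩; rfl
  · rintro k - _ ⟨saved, rfl, -⟩; rfl
  · rintro k hk _ ⟨saved, rfl, h⟩
    refine Runs.line (by simp [Prog.IsLine]) (by simp [Prog.lineCost, NatExpr.cost]) ?_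
    refine ⟨update saved k (μ.out k), by simp [Prog.effect, NatExpr.eval], fun i hi => ?_⟩
    rcases Nat.lt_succ_iff_lt_or_eq.mp hi with hi | rfl
    · rw [update_of_ne hi.ne, h i hi]
    · rw [update_self]
  · rintro _ ⟨saved, rfl, h⟩
    exact ⟨_, _, rfl, h⟩

theorem runs_better : Runs Prog.better μ.toState (μ.size 0 * (10 + 12) + 20) fun σ =>
    ∃ i out, σ = toState { μ with i := i, out := out } ∧
      ((μ.savedVal ≤ μ.val ∧ out = μ.out) ∨
        (μ.val ≤ μ.savedVal ∧ ∀ i < μ.size 0, out i = μ.saved i)) := by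
  refine Runs.mono (c := 5 + (μ.size 0 * (10 + 12) + 10) + 1) (Runs.cond ?_ ?_) (by omega)
    fun _ h => h
  · intro hb
    refine Runs.line (by simp [Prog.IsLine]) (by simp only [Prog.lineCost]; omega) ?_
    exact ⟨μ.i, μ.out, rfl, Or.inl ⟨hb, rfl⟩⟩
  · intro hb
    refine Runs.forLoop (N := μ.size 0) (fun k σ => ∃ out,
        σ = toState { μ with i := k, out := out } ∧ ∀ i < k, out i = μ.saved i) ?_ ?_ ?_ ?_ ?_
    · exact ⟨μ.out, by rw [write_i], fun i hi => absurd hi (Nat.not_lt_zero i)⟩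
    · rintro k - _ ⟨out, rfl, -⟩; rfl
    · rintro k - _ ⟨out, rfl, -⟩; rfl
    · rintro k hk _ ⟨out, rfl, h⟩
      refine Runs.line (by simp [Prog.IsLine]) (by simp [Prog.lineCost, NatExpr.cost]) ?_
      refine ⟨update out k (μ.saved k), by simp [Prog.effect, NatExpr.eval], fun i hi => ?_⟩
      rcases Nat.lt_succ_iff_lt_or_eq.mp hi with hi | rfl
      · rw [update_of_ne hi.ne, h i hi]
      · rw [update_self]
    · rintro _ ⟨out, rfl, h⟩
      exact ⟨_, _, rfl, Or.inr ⟨(not_le.mp hb).le, h⟩⟩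

end Mem

/-! ### The analysis of the output -/

theorem sum_eq_sum_fin {n : ℕ} {S : Finset ℕ} (hS : S ⊆ range n) (f : ℕ → ℝ) :
    ∑ i ∈ S, f i = ∑ i : Fin n, if (i : ℕ) ∈ S then f i else 0 := by
  rw [← Finset.sum_range fun i => if i ∈ S then f i else 0, ← Finset.sum_filter,
    Finset.filter_mem_eq_inter, Finset.inter_eq_right.mpr hS]

namespace Instance

variable {I : Instance} {ν : Mem} {Λ : Layering}

theorem Layered.load_eq (h : I.Layered ν Λ) {S : Finset ℕ} (hS : S ⊆ range I.n)
    {x : Fin I.n → ℕ} (hx : ∀ i, x i = if (i : ℕ) ∈ S then 1 else 0) (t : Fin I.m) :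
    Λ.load S t = ∑ i with t ∈ I.interval i, ‖I.demand i‖ * (x i : ℝ) := by
  unfold Layering.load
  rw [sum_eq_sum_fin ((filter_subset _ _).trans hS), Finset.sum_filter]
  refine Finset.sum_congr rfl fun i _ => ?_
  have h1 : (i : ℕ) ∈ ({j ∈ S | Λ.first j ≤ t ∧ (t : ℕ) ≤ Λ.last j} : Finset ℕ) ↔
      (i : ℕ) ∈ S ∧ t ∈ I.interval i := by
    rw [mem_filter, h.first_eq, h.last_eq, interval, Finset.mem_Icc]
    simp [mem]
  simp only [h1, h.size_norm, hx]
  by_cases hs : (i : ℕ) ∈ S <;> simp [hs]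

theorem value_eq {S : Finset ℕ} (hS : S ⊆ range I.n) {x : Fin I.n → ℕ}
    (hx : ∀ i, x i = if (i : ℕ) ∈ S then 1 else 0) : I.value x = ∑ i ∈ S, I.mem.util i := by
  rw [sum_eq_sum_fin hS, value]
  refine Finset.sum_congr rfl fun i _ => ?_
  rw [hx]
  by_cases hs : (i : ℕ) ∈ S <;> simp [hs, mem]

/-- By the triangle inequality it suffices to bound the real load. All demands active at `t` are
active at the representative that dominates `t`, whose capacity is no larger, so the bound at the
representatives extends to all slots. -/
theorem Layered.feasible (h : I.Layered ν Λ) {S : Finset ℕ} (hS : S ⊆ range I.n)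
    {x : Fin I.n → ℕ} (hx : ∀ i, x i = if (i : ℕ) ∈ S then 1 else 0)
    (huser : ∀ i ∈ S, ∀ j ∈ S, Λ.user i = Λ.user j → i = j)
    (hload : ∀ s ∈ Λ.slots, Λ.load S s ≤ Λ.cap s) : I.Feasible 1 x where
  zero_or_one i := by
    rw [hx]
    split_ifs
    exacts [Or.inr rfl, Or.inl rfl]
  one_per_user k := by
    simp only [hx]
    rw [← Finset.sum_filter, Finset.sum_const, smul_eq_mul, mul_one, Finset.card_le_one]
    intro i hi j hj
    simp only [mem_filter, mem_univ, true_and] at hi hj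
    refine Fin.ext (huser i hi.2 j hj.2 ?_)
    rw [h.user_eq]
    simp [mem, hi.1, hj.1]
  capacity t := by
    rw [one_mul]
    calc ‖∑ i with t ∈ I.interval i, I.demand i * (x i : ℂ)‖
        ≤ ∑ i with t ∈ I.interval i, ‖I.demand i‖ * (x i : ℝ) := by
          refine (norm_sum_le _ _).trans (le_of_eq (Finset.sum_congr rfl fun i _ => ?_))
          rw [norm_mul, Complex.norm_natCast]
      _ = Λ.load S t := (h.load_eq hS hx t).symm
      _ ≤ I.cap t := by
          obtain ⟨s, hs, hc, hact⟩ := h.dom t t.2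
          have hcap : Λ.cap t = I.cap t := by rw [h.cap_eq]; simp [mem]
          rw [hcap] at hc
          refine le_trans ?_ ((hload s hs).trans hc)
          refine Finset.sum_le_sum_of_subset_of_nonneg ?_ fun i hi _ => ?_
          · intro i hi
            obtain ⟨hiS, h1, h2⟩ := mem_filter.mp hi
            exact mem_filter.mpr ⟨hiS, hact i (mem_range.mp (hS hiS)) h1 h2⟩
          · exact Λ.size_nonneg i (h.n_eq ▸ mem_range.mp (hS (mem_filter.mp hi).1))

/-- After the rotation by `-φ/2` the argument has absolute value at most `φ/2`, and the cosine
decreases on `[0, π]`. -/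
theorem norm_mul_cos_le {z : ℂ} {φ : ℝ} (h0 : 0 ≤ z.arg) (h1 : z.arg ≤ φ) (h2 : φ ≤ Real.pi) :
    ‖z‖ * Real.cos (φ / 2) ≤ (z * Complex.exp (-(φ / 2 : ℝ) * Complex.I)).re := by
  have h3 : (z * Complex.exp (-(φ / 2 : ℝ) * Complex.I)).re =
      ‖z‖ * Real.cos (z.arg - φ / 2) := by
    conv_lhs => rw [← Complex.norm_mul_exp_arg_mul_I z]
    rw [mul_assoc, ← Complex.exp_add, ← add_mul, Complex.re_ofReal_mul]
    congr 1
    rw [show ((z.arg : ℂ) + -((φ / 2 : ℝ) : ℂ)) = ((z.arg - φ / 2 : ℝ) : ℂ) by push_cast; ring,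
      Complex.exp_ofReal_mul_I_re]
  rw [h3]
  refine mul_le_mul_of_nonneg_left ?_ (norm_nonneg z)
  rw [← Real.cos_abs (z.arg - φ / 2)]
  refine Real.cos_le_cos_of_nonneg_of_le_pi (abs_nonneg _) (by linarith) ?_
  rw [abs_le]
  constructor <;> linarith

/-- Demands in a sector of angle `φ ≤ π` cannot cancel by more than a factor of `cos (φ / 2)`. -/
theorem sum_norm_mul_cos_le {ι : Type*} (s : Finset ι) {z : ι → ℂ} {x : ι → ℕ} {φ : ℝ}
    (h0 : ∀ i, 0 ≤ (z i).arg) (h1 : ∀ i, (z i).arg ≤ φ) (h2 : φ ≤ Real.pi) :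
    (∑ i ∈ s, ‖z i‖ * (x i : ℝ)) * Real.cos (φ / 2) ≤ ‖∑ i ∈ s, z i * (x i : ℂ)‖ := by
  set e := Complex.exp (-(φ / 2 : ℝ) * Complex.I) with he
  have hnorm : ‖e‖ = 1 := by
    rw [he, ← Complex.ofReal_neg, Complex.norm_exp_ofReal_mul_I]
  calc (∑ i ∈ s, ‖z i‖ * (x i : ℝ)) * Real.cos (φ / 2)
      = ∑ i ∈ s, (x i : ℝ) * (‖z i‖ * Real.cos (φ / 2)) := by
        rw [Finset.sum_mul]
        exact Finset.sum_congr rfl fun i _ => by ring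
    _ ≤ ∑ i ∈ s, (x i : ℝ) * (z i * e).re := by
        refine Finset.sum_le_sum fun i _ => mul_le_mul_of_nonneg_left ?_ (Nat.cast_nonneg _)
        exact norm_mul_cos_le (h0 i) (h1 i) h2
    _ = ((∑ i ∈ s, z i * (x i : ℂ)) * e).re := by
        rw [Finset.sum_mul, Complex.re_sum]
        refine Finset.sum_congr rfl fun i _ => ?_
        rw [mul_right_comm, mul_comm (z i * e), ← Complex.ofReal_natCast, Complex.re_ofReal_mul]
    _ ≤ ‖(∑ i ∈ s, z i * (x i : ℂ)) * e‖ := Complex.re_le_norm _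
    _ = _ := by rw [norm_mul, hnorm, mul_one]

/-- An optimal solution, as a set of demands. -/
theorem Layered.exists_opt (h : I.Layered ν Λ) (hsec : I.InSector 0 (Real.pi / 2)) :
    ∃ T ⊆ range I.n, (∀ i ∈ T, ∀ j ∈ T, Λ.user i = Λ.user j → i = j) ∧
      (∀ s ∈ Λ.slots, Λ.load T s ≤ 1 / Real.cos (I.maxArg / 2) * Λ.cap s) ∧
      I.opt = ∑ i ∈ T, I.mem.util i := by
  obtain ⟨hsec0, hφ0, hφ⟩ := hsec
  have hpi := Real.pi_pos
  obtain ⟨x, hx, hopt⟩ := I.isGreatest_opt.1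
  have hTmem : ∀ i : Fin I.n,
      (i : ℕ) ∈ (univ.filter fun i => x i = 1).map Fin.valEmbedding ↔ x i = 1 := by
    intro i
    rw [Finset.mem_map]
    constructor
    · rintro ⟨j, hj, hji⟩
      rw [← Fin.ext hji]
      exact (mem_filter.mp hj).2
    · exact fun hi => ⟨i, mem_filter.mpr ⟨mem_univ _, hi⟩, rfl⟩
  set T := (univ.filter fun i => x i = 1).map Fin.valEmbedding with hT
  have hTn : T ⊆ range I.n := by
    intro i hi
    obtain ⟨j, -, rfl⟩ := Finset.mem_map.mp hi
    exact mem_range.mpr j.2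
  have hxT : ∀ i, x i = if (i : ℕ) ∈ T then 1 else 0 := by
    intro i
    rcases hx.zero_or_one i with h0 | h0
    · rw [if_neg (fun hh => by have := (hTmem i).mp hh; omega), h0]
    · rw [if_pos ((hTmem i).mpr h0), h0]
  refine ⟨T, hTn, ?_, ?_, by rw [← hopt, value_eq hTn hxT]⟩
  · intro i hi j hj hu
    obtain ⟨i, hi', rfl⟩ := Finset.mem_map.mp hi
    obtain ⟨j, hj', rfl⟩ := Finset.mem_map.mp hj
    have hi1 := (mem_filter.mp hi').2
    have hj1 := (mem_filter.mp hj').2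
    by_contra hne
    have hne' : i ≠ j := fun hh => hne (by rw [hh])
    have hu' : I.user i = I.user j := by
      rw [h.user_eq] at hu
      simpa [mem, Fin.ext_iff] using hu
    have h1 := hx.one_per_user (I.user i)
    have h2 : ∑ k ∈ {i, j}, x k ≤ ∑ k with I.user k = I.user i, x k := by
      refine Finset.sum_le_sum_of_subset fun k hk => ?_
      rcases mem_insert.mp hk with rfl | hk
      · simp
      · rw [mem_singleton.mp hk]; simp [hu']
    rw [Finset.sum_pair hne'] at h2
    omega
  · intro s hs
    have hcos : 0 < Real.cos (I.maxArg / 2) :=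
      Real.cos_pos_of_mem_Ioo ⟨by linarith, by linarith⟩
    have hload := h.load_eq hTn hxT ⟨s, h.slot_lt s hs⟩
    have h1 := sum_norm_mul_cos_le (univ.filter fun i => (⟨s, h.slot_lt s hs⟩ : Fin I.m) ∈
      I.interval i) (z := I.demand) (x := x) (φ := I.maxArg) hsec0
      (fun i => le_ciSup (f := fun i => (I.demand i).arg) (Set.finite_range _).bddAbove i)
      (by linarith)
    have h2 := hx.capacity ⟨s, h.slot_lt s hs⟩
    rw [one_mul] at h2
    have hcap : Λ.cap s = I.cap ⟨s, h.slot_lt s hs⟩ := by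
      rw [h.cap_eq]
      exact toArray_of_lt _ _
    rw [hcap, one_div, ← div_eq_inv_mul, le_div_iff₀ hcos, hload]
    exact h1.trans h2

theorem runs_schedule (I : Instance) (hsec : I.InSector 0 (Real.pi / 2)) (hI : I.NoBottleneck) :
    Runs Prog.schedule I.input (3000 * (I.n ^ 2 + I.m)) fun σ =>
      I.IsApprox (1 / 25 * Real.cos (I.maxArg / 2)) 1 (I.output σ) := by
  have hnn : I.n ≤ I.n ^ 2 := Nat.le_self_pow two_ne_zero _
  have hm := I.m_pos
  rw [input_eq]
  -- The constant terms are absorbed by `m ≥ 1`, the linear ones by `n ≤ n ^ 2`.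
  refine Runs.mono (c := 1000 * (I.n ^ 2 + I.m) + (500 * (I.n ^ 2 + 1) + ((I.n * 22 + 20) +
    (500 * (I.n ^ 2 + 1) + (I.n * 22 + 20))))) ?_ (by omega) fun _ h => h
  refine Runs.seq (I.runs_layers hI) ?_
  rintro _ ⟨ν, Λ, rfl, hν⟩
  have hord : ∀ k < ν.size 0, ∃ i < ν.size 0, Λ.rank i = k ∧ ν.ord k = i := by
    rw [hν.size_eq]
    intro k hk
    obtain ⟨i, hi, rfl⟩ := hν.rank_surj k hk
    exact ⟨i, hi, rfl, hν.ord_rank i hi⟩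
  have hinj : ∀ i < ν.size 0, ∀ j < ν.size 0, Λ.rank i = Λ.rank j → i = j := by
    rw [hν.size_eq, ← hν.n_eq]
    exact Λ.rank_inj
  have hlt : ∀ i < ν.size 0, Λ.rank i < ν.size 0 := by
    rw [hν.size_eq]
    exact hν.rank_lt
  have hlarge : ∀ i : ℕ, (ν.anchor i ≤ ν.top ∧ ν.top ≤ ν.anchor i) ∧
      ¬ ((2 : ℚ) : ℝ) * ν.norm i ≤ ν.top ↔ Λ.Large i := by
    intro i
    rw [← le_antisymm_iff, hν.anchor_eq, hν.top_eq, hν.norm_eq, not_le]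
    norm_num [Layering.Large]
  refine Runs.seq (Runs.mono (ν.runs_localRatio (act := fun i => ¬ Λ.Large i) (3 / 10)
    (by simp [Prog.largeTest, Test.cost, RealExpr.cost, NatExpr.cost])
    (fun i _ _ _ _ => not_congr (hlarge i)) hord hinj hlt) (by rw [hν.size_eq]) fun _ h => h) ?_
  rintro _ ⟨i₁, j₁, k₁, pos₁, acc₁, out₁, gain₁, weight₁, rfl, hw₁, h01₁, hg₁, hS₁⟩
  refine Runs.seq (Runs.mono (Mem.runs_save _) (by simp only [hν.size_eq]; omega) fun _ h => h) ?_
  rintro _ ⟨i₂, saved, rfl, hsaved⟩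
  refine Runs.seq (Runs.mono (Mem.runs_localRatio _ (act := Λ.Large) (1 / 2)
    (by simp [Prog.largeTest, Test.cost, RealExpr.cost, NatExpr.cost])
    (fun i _ _ _ _ => hlarge i) hord hinj hlt) (by simp only [hν.size_eq]; omega) fun _ h => h) ?_
  rintro _ ⟨i₃, j₃, k₃, pos₃, acc₃, out₃, gain₃, weight₃, rfl, hw₃, h01₃, hg₃, hS₃⟩
  refine Runs.mono (Mem.runs_better _) (by simp only [hν.size_eq]; omega) ?_
  rintro _ ⟨i₄, out, rfl, hout⟩
  simp only [hν.size_eq, hν.user_eq', hν.first_eq', hν.last_eq', hν.crit_eq, hν.norm_eq,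
    hν.anchor_eq, hν.util_eq] at hw₁ h01₁ hg₁ hS₁ hsaved hw₃ h01₃ hg₃ hS₃ hout
  rw [← hν.n_eq] at hg₁ hS₁ hg₃ hS₃ hsaved hout h01₁ h01₃
  push_cast at hg₁ hS₁ hg₃ hS₃
  change IsGain Λ.n Λ.rank (Λ.weight (3 / 10)) weight₁ gain₁ at hg₁
  change IsGain Λ.n Λ.rank (Λ.weight (1 / 2)) weight₃ gain₃ at hg₃
  change IsSelected Λ.n Λ.rank (Λ.weight (3 / 10)) gain₁ _ at hS₁
  change IsSelected Λ.n Λ.rank (Λ.weight (1 / 2)) gain₃ _ at hS₃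
  rw [← hν.n_eq] at hw₁ hw₃
  have hupos : ∀ i < Λ.n, 0 ≤ I.mem.util i := by
    intro i hi
    rw [hν.n_eq] at hi
    simp only [mem, toArray_of_lt _ hi]
    exact (I.utility_pos _).le
  -- Demands of the other class have weight `0` in this run and are not selected.
  have hsmall : ∀ i ∈ Mem.chosen Λ.n out₁, ¬ Λ.Large i := fun i hi hl => by
    have h1 := hS₁.weight_pos hg₁ (Λ.weight_nonneg (by norm_num)) hi
    rw [(hw₁ i (mem_range.mp (hS₁.subset hi))).2 (not_not.mpr hl)] at h1
    exact lt_irrefl _ h1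
  have hbig : ∀ i ∈ Mem.chosen Λ.n out₃, Λ.Large i := fun i hi => by
    by_contra hl
    have h1 := hS₃.weight_pos hg₃ (Λ.weight_nonneg (by norm_num)) hi
    rw [(hw₃ i (mem_range.mp (hS₃.subset hi))).2 hl] at h1
    exact lt_irrefl _ h1
  obtain ⟨T, hT, hTuser, hTload, hopt⟩ := hν.exists_opt hsec
  obtain ⟨hsec0, hφ0, hφ⟩ := hsec
  have hpi := Real.pi_pos
  have hcos : 0 < Real.cos (I.maxArg / 2) := Real.cos_pos_of_mem_Ioo ⟨by linarith, by linarith⟩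
  have hγ : 1 ≤ 1 / Real.cos (I.maxArg / 2) := by
    rw [one_le_div hcos]
    exact Real.cos_le_one _
  have hvalue := Λ.value_le hγ (u := I.mem.util) (T := T)
    (fun i hi => ⟨fun hl => (hw₁ i hi).2 (not_not.mpr hl), (hw₁ i hi).1⟩) hw₃ hupos hg₁ hg₃ hS₁ hS₃
    (hν.n_eq ▸ hT) hTuser hTload
  rw [← hopt] at hvalue
  have approx : ∀ (x : Fin I.n → ℕ), ∀ S ⊆ range Λ.n, (∀ i, x i = if (i : ℕ) ∈ S then 1 else 0) →
      (∀ i ∈ S, ∀ j ∈ S, Λ.user i = Λ.user j → i = j) →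
      (∀ s ∈ Λ.slots, Λ.load S s ≤ Λ.cap s) →
      max (∑ i ∈ Mem.chosen Λ.n out₁, I.mem.util i) (∑ i ∈ Mem.chosen Λ.n out₃, I.mem.util i) ≤
        ∑ i ∈ S, I.mem.util i →
      I.IsApprox (1 / 25 * Real.cos (I.maxArg / 2)) 1 x := by
    intro x S hS hx huser hload hmax
    rw [hν.n_eq] at hS
    refine ⟨hν.feasible hS hx huser hload, ?_⟩
    rw [value_eq hS hx]
    refine le_trans ?_ hmax
    calc 1 / 25 * Real.cos (I.maxArg / 2) * I.opt
        ≤ 1 / 25 * Real.cos (I.maxArg / 2) * (25 * (1 / Real.cos (I.maxArg / 2)) * _) :=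
          mul_le_mul_of_nonneg_left hvalue (by positivity)
      _ = _ := by field_simp
  have hchosen : ∀ (out' : ℕ → ℕ), (∀ i < Λ.n, out' i = 0 ∨ out' i = 1) → ∀ i : Fin I.n,
      out' i = if (i : ℕ) ∈ Mem.chosen Λ.n out' then 1 else 0 := by
    intro out' h01 i
    have hi : (i : ℕ) < Λ.n := i.2.trans_eq hν.n_eq.symm
    rcases h01 i hi with h0 | h0 <;> simp [Mem.chosen, h0, hi]
  rcases hout with ⟨hle, rfl⟩ | ⟨hle, hout⟩
  · refine approx _ _ hS₃.subset (fun i => hchosen out h01₃ i)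
      (Λ.user_injOn (by norm_num) hS₃) (fun s hs => Λ.load_le_of_large hS₃ hbig hs)
      (max_le hle le_rfl)
  · refine approx _ _ hS₁.subset (fun i => ?_)
      (Λ.user_injOn (by norm_num) hS₁) (fun s hs => Λ.load_le_of_small hS₁ hsmall hs)
      (max_le le_rfl hle)
    have hi : (i : ℕ) < Λ.n := i.2.trans_eq hν.n_eq.symm
    rw [← hchosen out₁ h01₁ i, ← hsaved i hi, ← hout i hi]
    rfl

end Instance

end CSP

end

/-- One program, on every instance of the problem with demands constant over time and arguments in
`[0, π/2]` that satisfies the no-bottleneck assumption, halts after `O(n² + m)` steps with a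
`(cos (φ / 2) / 25, 1)`-approximation, which is also an `(α, 1)`-approximation for an absolute
constant `α > 0`. -/
theorem mainTheorem4 :
    ∃ (P : CSP.Prog) (K : ℕ) (α : ℝ), 0 < α ∧ α ≤ 1 ∧
      ∀ I : CSP.Instance, I.InSector 0 (Real.pi / 2) → I.NoBottleneck →
        ∃ (σ : CSP.State) (steps : ℕ),
          CSP.Exec P I.input σ steps ∧
          steps ≤ K * (I.n ^ 2 + I.m) ∧
          I.IsApprox (1 / 25 * Real.cos (I.maxArg / 2)) 1 (I.output σ) ∧
          I.IsApprox α 1 (I.output σ) := by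
  refine ⟨CSP.Prog.schedule, 3000, 1 / 50, by norm_num, by norm_num, fun I hsec hI => ?_⟩
  obtain ⟨σ, steps, hexec, hsteps, happrox⟩ := I.runs_schedule hsec hI
  refine ⟨σ, steps, hexec, hsteps, happrox, happrox.1, le_trans ?_ happrox.2⟩
  have hopt : 0 ≤ I.opt := by
    obtain ⟨x, -, hx⟩ := I.isGreatest_opt.1
    rw [← hx]
    exact Finset.sum_nonneg fun i _ => mul_nonneg (I.utility_pos i).le (Nat.cast_nonneg _)
  obtain ⟨-, hφ0, hφ⟩ := hsec
  have hpi := Real.pi_pos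
  -- Here `φ/2 ≤ π/4 ≤ π/3`, so the cosine is at least `1/2`; this gives the absolute constant
  -- `1/50`.
  have hcos : Real.cos (Real.pi / 3) ≤ Real.cos (I.maxArg / 2) :=
    Real.cos_le_cos_of_nonneg_of_le_pi (by linarith) (by linarith) (by linarith)
  rw [Real.cos_pi_div_three] at hcos
  exact mul_le_mul_of_nonneg_right (by linarith) hopt
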